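/- **Theories.** Literals are $p$ and $\neg p$ for propositions $p$; ${\sim}q$ is the complement of $q$. A defeasible theory $D=(F,R,>)$ consists of a set $F$ of literals (facts), a finite set $R$ of rules with distinct labels, each having a finite body of literals, a head literal, and one of the types strict, defeasible, defeater; and an acyclic relation $>$ on labels. Rules that are strict or defeasible are called supportive; $A(r)$ is the body of $r$; $R_s[q]$, $R_{sd}[q]$, $R[q]$ are the strict rules, the supportive rules and all rules with head $q$. The proof tags are $\partial,\partial^*,\delta,\delta^*$; a tag is a proof tag or $\mathsf{free}$. An annotated literal is $t\,q$ with $t$ a tag. In an annotated defeasible theory the bodies of defeasible rules and defeaters consist of annotated literals $t\,q$ and fail-expressions $\mathsf{fail}\;t\,q$; strict rules are not annotated. An unannotated literal $q$ is identified with $\mathsf{free}\;q$ wherever an annotated literal is expected. $\alpha_F(D)$ is the annotated theory obtained from $D$ by annotating every body literal occurrence with $\mathsf{free}$. **The proof systems $\mathbf{DL}(d)$.** Conclusions are $\pm\Delta q$, $\pm d\,q$ and, for $d\in\{\delta,\delta^*\}$, $\pm\sigma_d q$. A proof is a finite sequence of conclusions each of which is inferred from earlier ones by one of the rules below ("$c$"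 means "$c$ occurs earlier"); $D\vdash c$ for a conclusion $c$ with tag $d$ or $\sigma_d$ means that $c$ occurs in a proof of $\mathbf{DL}(d)$. For $d\in\{\partial,\partial^*\}$ let $\tau=d$, and for $d\in\{\delta,\delta^*\}$ let $\tau=\sigma_d$. * $+\Delta q$ if $q\in F$ or $\exists r\in R_s[q]\,\forall a\in A(r)\,(+\Delta a)$. $\;-\Delta q$ if $q\notin F$ and $\forall r\in R_s[q]\,\exists a\in A(r)\,(-\Delta a)$. * For $d\in\{\partial,\delta\}$: $+d\,q$ if $+\Delta q$, or all of: $\exists r\in R_{sd}[q]\,\forall a\in A(r)\,(+d\,a)$; $-\Delta{\sim}q$; and for all $s\in R[{\sim}q]$, either $\exists a\in A(s)\,(-\tau a)$ or there is $t\in R_{sd}[q]$ with $t>s$ and $\forall a\in A(t)\,(+d\,a)$. $\;-d\,q$ if $-\Delta q$ and one of: $\forall r\in R_{sd}[q]\,\exists a\in A(r)\,(-d\,a)$; $+\Delta{\sim}q$; or there is $s\in R[{\sim}q]$ with $\forall a\in A(s)\,(+\tau a)$ such that each $t\in R_{sd}[q]$ has $\exists a\in A(t)\,(-d\,a)$ or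 $t\not>s$. * For $d\in\{\partial^*,\delta^*\}$: $+d\,q$ if $+\Delta q$, or there is $r\in R_{sd}[q]$ with $\forall a\in A(r)\,(+d\,a)$, $-\Delta{\sim}q$, and for all $s\in R[{\sim}q]$ either $\exists a\in A(s)\,(-\tau a)$ or $r>s$. $\;-d\,q$ if $-\Delta q$ and for each $r\in R_{sd}[q]$ one of: $\exists a\in A(r)\,(-d\,a)$; $+\Delta{\sim}q$; or there is $s\in R[{\sim}q]$ with $\forall a\in A(s)\,(+\tau a)$ and $r\not>s$. * For $d\in\{\delta,\delta^*\}$: $+\sigma_d q$ if $+\Delta q$, or there is $r\in R_{sd}[q]$ with $\forall a\in A(r)\,(+\sigma_d a)$ and for all $s\in R[{\sim}q]$ either $\exists a\in A(s)\,(-d\,a)$ or $s\not>r$. $\;-\sigma_d q$ if $-\Delta q$ and for each $r\in R_{sd}[q]$ either $\exists a\in A(r)\,(-\sigma_d a)$ or there is $s\in R[{\sim}q]$ with $\forall a\in A(s)\,(+d\,a)$ and $s>r$. **The meta-program.** For an annotated theory $D$, $\mathcal M(D)$ is the logic program consisting of facts that list the elements of $F$, the rules of each type (label, head, body), the pairs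 of rules with $r>s$, and the four proof tags, together with all ground instances of the following clauses. Here $X$ is a plain literal, $L$ an annotated literal, $Y,Z$ are proof tags, $T$ is any tag, and a predicate applied to a body $\vec W$ stands for the conjunction over its elements. * $\mathsf{definitely}(X)\leftarrow \mathsf{fact}(X)$; $\;\mathsf{definitely}(X)\leftarrow \mathsf{strict}(R,X,\vec W),\mathsf{definitely}(\vec W)$. Supportive rules are the strict and the defeasible ones; rules are the supportive ones and the defeaters. * $\mathsf{defeasibly}_Z(\mathsf{free}\,X)\leftarrow\mathsf{defeasibly}_Z(Z\,X)$; $\;\mathsf{defeasibly}_Z(\mathsf{fail}\,L)\leftarrow\mathsf{not}\ \mathsf{defeasibly}_Z(L)$; $\;\mathsf{defeasibly}_Z(T\,X)\leftarrow\mathsf{definitely}(X)$; $\;\mathsf{defeasibly}_Z(Y\,X)\leftarrow\mathsf{not}\ \mathsf{definitely}({\sim}X),\mathsf{supportive\_rule}(R,X,\vec W),\mathsf{defeasibly}_Y(\vec W),\mathsf{not}\ \mathsf{overruled}_Y(R,X)$. * $\mathsf{overruled}_Z(R,X)\leftarrow\mathsf{rule}(S,{\sim}X,\vec U),\beta_Z(\vec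 U),\mathsf{not}\ \mathsf{defeated}_Z(R,S,{\sim}X)$, where $\beta=\mathsf{defeasibly}$ for $Z\in\{\partial,\partial^*\}$ and $\beta=\mathsf{supported}$ for $Z\in\{\delta,\delta^*\}$. * For $Z\in\{\partial,\delta\}$: $\mathsf{defeated}_Z(R,S,{\sim}X)\leftarrow\mathsf{sup}(T',S),\mathsf{supportive\_rule}(T',X,\vec V),\mathsf{defeasibly}_Z(\vec V)$. For $Z\in\{\partial^*,\delta^*\}$: $\mathsf{defeated}_Z(R,S,{\sim}X)\leftarrow\mathsf{sup}(R,S)$. * $\mathsf{supported}_Z(\mathsf{free}\,X)\leftarrow\mathsf{supported}_Z(Z\,X)$; $\;\mathsf{supported}_Z(\mathsf{fail}\,L)\leftarrow\mathsf{not}\ \mathsf{supported}_Z(L)$; $\;\mathsf{supported}_Z(T\,X)\leftarrow\mathsf{definitely}(X)$; $\;\mathsf{supported}_Z(Y\,X)\leftarrow\mathsf{supportive\_rule}(R,X,\vec W),\mathsf{supported}_Y(\vec W),\mathsf{not}\ \mathsf{beaten}_Y(R,X)$; $\;\mathsf{beaten}_Z(R,X)\leftarrow\mathsf{rule}(S,{\sim}X,\vec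 W),\mathsf{defeasibly}_Z(\vec W),\mathsf{sup}(S,R)$. **Kunen's semantics.** For a program $P$, Fitting's operator $\Phi$ maps a three-valued interpretation $I$ to the one in which an atom is true if some clause for it has a body true in $I$, and false if every clause for it has a body false in $I$. $\Phi\uparrow n$ is its $n$-th iterate from the everywhere undefined interpretation. $P\models_K a$ (resp. $P\models_K\neg a$) means that the atom $a$ is true (resp. false) in $\Phi\uparrow n$ for some finite $n$. **Corollary (annotated defeasible logic is a conservative extension of $\mathbf{DL}(d)$).** Let $D$ be a defeasible theory and $d\in\{\delta^*,\delta,\partial^*,\partial\}$. Then for every literal $q$ * $\mathcal M(\alpha_F(D))\models_K\mathsf{defeasibly}_d(q)$ iff $D\vdash+d\,q$; * $\mathcal M(\alpha_F(D))\models_K\neg\mathsf{defeasibly}_d(q)$ iff $D\vdash-d\,q$. Furthermore, if $d\in\{\delta^*,\delta\}$, * $\mathcal M(\alpha_F(D))\models_K\mathsf{supported}_d(q)$ iff $D\vdash+\sigma_d q$; * $\mathcal M(\alpha_F(D))\models_K\neg\mathsf{supported}_d(q)$ iff $D\vdash-\sigma_d q$. The same four equivalences hold with the argument $q$ on the left (that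 is, $\mathsf{free}\;q$) replaced by $d\,q$. -/

import Mathlib

namespace ADL

/-! ## Literals, rules and theories -/

/-- Propositional literals over a set `P` of propositions. -/
inductive Literal (P : Type*) where
  | pos (p : P)
  | neg (p : P)

/-- The complement of `p` is `¬ p`, the complement of `¬ p` is `p`. -/
def Literal.compl {P : Type*} : Literal P → Literal P
  | .pos p => .neg p
  | .neg p => .pos p

/-- Labelled rules. Bodies of strict rules always consist of plain literals; bodies of defeasible
rules and of defeaters consist of elements of `B` (plain literals in an ordinary theory, annotated
literals and fail-expressions in an annotated theory). -/
inductive Rule (P Λ B : Type*) where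
  | strict (label : Λ) (body : List (Literal P)) (head : Literal P)
  | defeasible (label : Λ) (body : List B) (head : Literal P)
  | defeater (label : Λ) (body : List B) (head : Literal P)

namespace Rule

variable {P Λ B : Type*}

def label : Rule P Λ B → Λ
  | strict l _ _ => l
  | defeasible l _ _ => l
  | defeater l _ _ => l

def head : Rule P Λ B → Literal P
  | strict _ _ h => h
  | defeasible _ _ h => h
  | defeater _ _ h => h

/-- The antecedent of an unannotated rule. -/
def antecedent : Rule P Λ (Literal P) → List (Literal P)
  | strict _ b _ => b
  | defeasible _ b _ => b
  | defeater _ b _ => b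

def IsStrict : Rule P Λ B → Prop
  | strict _ _ _ => True
  | defeasible _ _ _ => False
  | defeater _ _ _ => False

/-- Strict or defeasible, that is, not a defeater. -/
def IsSupportive : Rule P Λ B → Prop
  | strict _ _ _ => True
  | defeasible _ _ _ => True
  | defeater _ _ _ => False

end Rule

/-- A theory `(F, R, >)`: facts, finitely many rules with distinct labels, and an acyclic
superiority relation on labels (`sup r s` means `r > s`). -/
structure Theory (P Λ B : Type*) where
  facts : Set (Literal P)
  rules : Set (Rule P Λ B)
  finite_rules : rules.Finite
  label_injOn : Set.InjOn Rule.label rules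
  sup : Λ → Λ → Prop
  sup_acyclic : ∀ l, ¬ Relation.TransGen sup l l

/-- Ordinary (unannotated) defeasible theories. -/
abbrev DefeasibleTheory (P Λ : Type*) := Theory P Λ (Literal P)

/-! ## Tags and annotated theories -/

/-- The four proof tags `∂`, `∂*`, `δ`, `δ*`. -/
inductive ProofTag where
  | partialTag
  | partialStar
  | delta
  | deltaStar

/-- A tag is a proof tag or `free`. -/
inductive Tag where
  | proof (d : ProofTag)
  | free

/-- An annotated literal `t q`. -/
structure AnnLit (P : Type*) where
  tag : Tag
  lit : Literal P

/-- Body expressions of annotated rules: an annotated literal `t q`, or a fail-expression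
`fail t q`. -/
inductive BodyExpr (P : Type*) where
  | lit (A : AnnLit P)
  | fail (A : AnnLit P)

/-- Annotated defeasible theories (strict rules are not annotated). -/
abbrev AnnotatedTheory (P Λ : Type*) := Theory P Λ (BodyExpr P)

/-- An annotation function maps each body literal occurrence, given by the label of the rule and
the position in its body, to a tag. Values at non-occurrences are not used. -/
abbrev Annotation (Λ : Type*) := Λ → ℕ → Tag

/-- The free annotation function maps every occurrence to `free`. -/
def freeAnnotation (Λ : Type*) : Annotation Λ := fun _ _ => Tag.free

def Rule.annotate {P Λ : Type*} (α : Annotation Λ) : Rule P Λ (Literal P) → Rule P Λ (BodyExpr P)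
  | strict l b h => strict l b h
  | defeasible l b h => defeasible l (b.mapIdx fun i q => BodyExpr.lit ⟨α l i, q⟩) h
  | defeater l b h => defeater l (b.mapIdx fun i q => BodyExpr.lit ⟨α l i, q⟩) h

theorem Rule.label_annotate {P Λ : Type*} (α : Annotation Λ) (r : Rule P Λ (Literal P)) :
    (r.annotate α).label = r.label := by
  cases r <;> rfl

/-- The annotated theory `α(D)` with underlying theory `D`. -/
def Theory.annotate {P Λ : Type*} (D : DefeasibleTheory P Λ) (α : Annotation Λ) :
    AnnotatedTheory P Λ where
  facts := D.facts
  rules := Rule.annotate α '' D.rules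
  finite_rules := D.finite_rules.image _
  label_injOn := by
    rintro _ ⟨r, hr, rfl⟩ _ ⟨s, hs, rfl⟩ h
    rw [Rule.label_annotate, Rule.label_annotate] at h
    rw [D.label_injOn hr hs h]
  sup := D.sup
  sup_acyclic := D.sup_acyclic

/-! ## Logic programs and Kunen semantics -/

/-- Literals of a logic program: an atom, or `not` applied to an atom. -/
inductive ProgLit (A : Type*) where
  | pos (a : A)
  | not (a : A)

/-- A ground clause `head :- body`. -/
structure Clause (A : Type*) where
  head : A
  body : List (ProgLit A)

/-- A (ground) logic program, possibly infinite: the set of all ground instances of its clauses. -/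
abbrev Program (A : Type*) := Set (Clause A)

/-- A partial (three-valued) interpretation: the set of true atoms and the set of false atoms. -/
structure PartialInterp (A : Type*) where
  trueSet : Set A
  falseSet : Set A

def ProgLit.IsTrue {A : Type*} (I : PartialInterp A) : ProgLit A → Prop
  | pos a => a ∈ I.trueSet
  | not a => a ∈ I.falseSet

def ProgLit.IsFalse {A : Type*} (I : PartialInterp A) : ProgLit A → Prop
  | pos a => a ∈ I.falseSet
  | not a => a ∈ I.trueSet

/-- Fitting's semantic function: an atom is made true if the body of some clause for it is true,
and false if the body of every clause for it is false (in Kleene's strong three-valued logic). -/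
def fitting {A : Type*} (Pr : Program A) (I : PartialInterp A) : PartialInterp A where
  trueSet := {a | ∃ c ∈ Pr, c.head = a ∧ ∀ L ∈ c.body, L.IsTrue I}
  falseSet := {a | ∀ c ∈ Pr, c.head = a → ∃ L ∈ c.body, L.IsFalse I}

/-- The finite iterates `Φ ↑ n`, starting with the interpretation in which all is undefined. -/
def fittingIter {A : Type*} (Pr : Program A) : ℕ → PartialInterp A
  | 0 => ⟨∅, ∅⟩
  | n + 1 => fitting Pr (fittingIter Pr n)

/-- Consequence under Kunen's semantics: truth in some finite iterate `Φ ↑ n`. -/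
def KunenEntails {A : Type*} (Pr : Program A) (L : ProgLit A) : Prop :=
  ∃ n : ℕ, L.IsTrue (fittingIter Pr n)

/-! ## The meta-program -/

/-- The (well-sorted) ground atoms of the meta-program. -/
inductive MetaAtom (P Λ : Type*) where
  | fact (p : Literal P)
  | strict (r : Λ) (p : Literal P) (body : List (Literal P))
  | defeasible (r : Λ) (p : Literal P) (body : List (BodyExpr P))
  | defeater (r : Λ) (p : Literal P) (body : List (BodyExpr P))
  | sup (r s : Λ)
  | team (Z : Tag)
  | indiv (Z : Tag)
  | ambiguityBlocking (Z : Tag)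
  | ambiguityPropagating (Z : Tag)
  | proofTag (Z : Tag)
  | supportiveRule (r : Λ) (p : Literal P) (body : List (BodyExpr P))
  | rule (r : Λ) (p : Literal P) (body : List (BodyExpr P))
  | definitely (p : Literal P)
  | defeasibly (Z : Tag) (e : BodyExpr P)
  | overruled (Z : Tag) (r : Λ) (p : Literal P)
  | defeated (Z : Tag) (r s : Λ) (p : Literal P)
  | supported (Z : Tag) (e : BodyExpr P)
  | beaten (Z : Tag) (r : Λ) (p : Literal P)

open MetaAtom ProgLit in
/-- The program `M(D)`: the ground instances of the clauses of the meta-program together with the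
facts that represent the annotated theory `D`. The arguments of `definitely` are plain literals.
A plain literal in the body of a strict rule counts as `free`-annotated when that rule is used as a
supportive rule, and a literal that is proved definitely is proved under each annotation.
Every clause for a predicate with subscript `Z` has `proofTag Z` in its body. -/
inductive MetaProgram {P Λ : Type*} (D : AnnotatedTheory P Λ) : Clause (MetaAtom P Λ) → Prop where
  -- representation of the theory
  | fact (p : Literal P) : p ∈ D.facts → MetaProgram D ⟨fact p, []⟩
  | strict (r : Λ) (p : Literal P) (b : List (Literal P)) :
      Rule.strict r b p ∈ D.rules → MetaProgram D ⟨strict r p b, []⟩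
  | defeasible (r : Λ) (p : Literal P) (b : List (BodyExpr P)) :
      Rule.defeasible r b p ∈ D.rules → MetaProgram D ⟨defeasible r p b, []⟩
  | defeater (r : Λ) (p : Literal P) (b : List (BodyExpr P)) :
      Rule.defeater r b p ∈ D.rules → MetaProgram D ⟨defeater r p b, []⟩
  | sup (r s : Rule P Λ (BodyExpr P)) : r ∈ D.rules → s ∈ D.rules → D.sup r.label s.label →
      MetaProgram D ⟨sup r.label s.label, []⟩
  -- classification of the tags
  | team_partial : MetaProgram D ⟨team (.proof .partialTag), []⟩
  | team_delta : MetaProgram D ⟨team (.proof .delta), []⟩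
  | indiv_partialStar : MetaProgram D ⟨indiv (.proof .partialStar), []⟩
  | indiv_deltaStar : MetaProgram D ⟨indiv (.proof .deltaStar), []⟩
  | blocking_partialStar : MetaProgram D ⟨ambiguityBlocking (.proof .partialStar), []⟩
  | blocking_partial : MetaProgram D ⟨ambiguityBlocking (.proof .partialTag), []⟩
  | propagating_deltaStar : MetaProgram D ⟨ambiguityPropagating (.proof .deltaStar), []⟩
  | propagating_delta : MetaProgram D ⟨ambiguityPropagating (.proof .delta), []⟩
  | proofTag (d : ProofTag) : MetaProgram D ⟨proofTag (.proof d), []⟩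
  -- classes of rules
  | supportive_strict (r : Λ) (p : Literal P) (b : List (Literal P)) :
      MetaProgram D ⟨supportiveRule r p (b.map fun q => BodyExpr.lit ⟨Tag.free, q⟩),
        [pos (strict r p b)]⟩
  | supportive_defeasible (r : Λ) (p : Literal P) (b : List (BodyExpr P)) :
      MetaProgram D ⟨supportiveRule r p b, [pos (defeasible r p b)]⟩
  | rule_supportive (r : Λ) (p : Literal P) (b : List (BodyExpr P)) :
      MetaProgram D ⟨rule r p b, [pos (supportiveRule r p b)]⟩
  | rule_defeater (r : Λ) (p : Literal P) (b : List (BodyExpr P)) :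
      MetaProgram D ⟨rule r p b, [pos (defeater r p b)]⟩
  -- monotonic provability
  | definitely_fact (x : Literal P) : MetaProgram D ⟨definitely x, [pos (fact x)]⟩
  | definitely_strict (r : Λ) (x : Literal P) (y : List (Literal P)) :
      MetaProgram D ⟨definitely x, pos (strict r x y) :: y.map fun a => pos (definitely a)⟩
  -- defeasible provability
  | defeasibly_free (Z : Tag) (x : Literal P) :
      MetaProgram D ⟨defeasibly Z (.lit ⟨.free, x⟩),
        [pos (proofTag Z), pos (defeasibly Z (.lit ⟨Z, x⟩))]⟩
  | defeasibly_fail (Z : Tag) (A : AnnLit P) :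
      MetaProgram D ⟨defeasibly Z (.fail A), [pos (proofTag Z), not (defeasibly Z (.lit A))]⟩
  | defeasibly_definitely (Z Y : Tag) (x : Literal P) :
      MetaProgram D ⟨defeasibly Z (.lit ⟨Y, x⟩), [pos (proofTag Z), pos (definitely x)]⟩
  | defeasibly_rule (Z Y : Tag) (x : Literal P) (r : Λ) (w : List (BodyExpr P)) :
      MetaProgram D ⟨defeasibly Z (.lit ⟨Y, x⟩),
        [pos (proofTag Z), pos (proofTag Y), not (definitely x.compl),
          pos (supportiveRule r x w)] ++
        (w.map fun e => pos (defeasibly Y e)) ++ [not (overruled Y r x)]⟩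
  | overruled_blocking (Z : Tag) (r s : Λ) (x : Literal P) (u : List (BodyExpr P)) :
      MetaProgram D ⟨overruled Z r x,
        [pos (proofTag Z), pos (ambiguityBlocking Z), pos (rule s x.compl u)] ++
        (u.map fun e => pos (defeasibly Z e)) ++ [not (defeated Z r s x.compl)]⟩
  | overruled_propagating (Z : Tag) (r s : Λ) (x : Literal P) (u : List (BodyExpr P)) :
      MetaProgram D ⟨overruled Z r x,
        [pos (proofTag Z), pos (ambiguityPropagating Z), pos (rule s x.compl u)] ++
        (u.map fun e => pos (supported Z e)) ++ [not (defeated Z r s x.compl)]⟩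
  | defeated_team (Z : Tag) (r s t : Λ) (x : Literal P) (v : List (BodyExpr P)) :
      MetaProgram D ⟨defeated Z r s x.compl,
        [pos (proofTag Z), pos (team Z), pos (sup t s), pos (supportiveRule t x v)] ++
        (v.map fun e => pos (defeasibly Z e))⟩
  | defeated_indiv (Z : Tag) (r s : Λ) (x : Literal P) :
      MetaProgram D ⟨defeated Z r s x.compl,
        [pos (proofTag Z), pos (indiv Z), pos (sup r s)]⟩
  -- support
  | supported_free (Z : Tag) (x : Literal P) :
      MetaProgram D ⟨supported Z (.lit ⟨.free, x⟩),
        [pos (proofTag Z), pos (supported Z (.lit ⟨Z, x⟩))]⟩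
  | supported_fail (Z : Tag) (A : AnnLit P) :
      MetaProgram D ⟨supported Z (.fail A), [pos (proofTag Z), not (supported Z (.lit A))]⟩
  | supported_definitely (Z Y : Tag) (x : Literal P) :
      MetaProgram D ⟨supported Z (.lit ⟨Y, x⟩), [pos (proofTag Z), pos (definitely x)]⟩
  | supported_rule (Z Y : Tag) (x : Literal P) (r : Λ) (w : List (BodyExpr P)) :
      MetaProgram D ⟨supported Z (.lit ⟨Y, x⟩),
        [pos (proofTag Z), pos (proofTag Y), pos (supportiveRule r x w)] ++
        (w.map fun e => pos (supported Y e)) ++ [not (beaten Y r x)]⟩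
  | beaten (Z : Tag) (r s : Λ) (x : Literal P) (w : List (BodyExpr P)) :
      MetaProgram D ⟨beaten Z r x,
        [pos (proofTag Z), pos (rule s x.compl w)] ++
        (w.map fun e => pos (defeasibly Z e)) ++ [pos (sup s r)]⟩

/-- `M(D)` as a program. -/
def metaProgram {P Λ : Type*} (D : AnnotatedTheory P Λ) : Program (MetaAtom P Λ) :=
  {c | MetaProgram D c}

/-! ## The proof systems `DL(d)` -/

/-- The tags of conclusions: `Δ`, `d` and `σ_d` for a proof tag `d`. -/
inductive ConclTag where
  | definite
  | main (d : ProofTag)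
  | supp (d : ProofTag)

/-- Conclusions `+t q` and `-t q`. -/
inductive Conclusion (P : Type*) where
  | plus (t : ConclTag) (q : Literal P)
  | minus (t : ConclTag) (q : Literal P)

/-- `R_s[q]`, the strict rules with head `q`. -/
def Theory.strictRules {P Λ B : Type*} (D : Theory P Λ B) (q : Literal P) : Set (Rule P Λ B) :=
  {r | r ∈ D.rules ∧ r.IsStrict ∧ r.head = q}

/-- `R_sd[q]`, the strict or defeasible rules with head `q`. -/
def Theory.supportiveRules {P Λ B : Type*} (D : Theory P Λ B) (q : Literal P) :
    Set (Rule P Λ B) :=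
  {r | r ∈ D.rules ∧ r.IsSupportive ∧ r.head = q}

/-- `R[q]`, all rules (defeaters included) with head `q`. -/
def Theory.rulesFor {P Λ B : Type*} (D : Theory P Λ B) (q : Literal P) : Set (Rule P Λ B) :=
  {r | r ∈ D.rules ∧ r.head = q}

open ConclTag ProofTag Conclusion in
/-- `Infers D d S c`: by one of the inference rules of `DL(d)`, the conclusion `c` can be inferred
when `S` is the set of conclusions that have been proved already. -/
inductive Infers {P Λ : Type*} (D : DefeasibleTheory P Λ) :
    ProofTag → Set (Conclusion P) → Conclusion P → Prop where
  | plus_definite (d : ProofTag) (S : Set (Conclusion P)) (q : Literal P) :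
      (q ∈ D.facts ∨ ∃ r ∈ D.strictRules q, ∀ a ∈ r.antecedent, plus definite a ∈ S) →
      Infers D d S (plus definite q)
  | minus_definite (d : ProofTag) (S : Set (Conclusion P)) (q : Literal P) :
      (q ∉ D.facts ∧ ∀ r ∈ D.strictRules q, ∃ a ∈ r.antecedent, minus definite a ∈ S) →
      Infers D d S (minus definite q)
  | plus_partial (S : Set (Conclusion P)) (q : Literal P) :
      (plus definite q ∈ S ∨
        ((∃ r ∈ D.supportiveRules q, ∀ a ∈ r.antecedent, plus (main partialTag) a ∈ S) ∧
          minus definite q.compl ∈ S ∧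
          ∀ s ∈ D.rulesFor q.compl,
            (∃ a ∈ s.antecedent, minus (main partialTag) a ∈ S) ∨
            ∃ t ∈ D.supportiveRules q,
              (∀ a ∈ t.antecedent, plus (main partialTag) a ∈ S) ∧ D.sup t.label s.label)) →
      Infers D partialTag S (plus (main partialTag) q)
  | minus_partial (S : Set (Conclusion P)) (q : Literal P) :
      (minus definite q ∈ S ∧
        ((∀ r ∈ D.supportiveRules q, ∃ a ∈ r.antecedent, minus (main partialTag) a ∈ S) ∨
          plus definite q.compl ∈ S ∨
          ∃ s ∈ D.rulesFor q.compl,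
            (∀ a ∈ s.antecedent, plus (main partialTag) a ∈ S) ∧
            ∀ t ∈ D.supportiveRules q,
              (∃ a ∈ t.antecedent, minus (main partialTag) a ∈ S) ∨ ¬ D.sup t.label s.label)) →
      Infers D partialTag S (minus (main partialTag) q)
  | plus_delta (S : Set (Conclusion P)) (q : Literal P) :
      (plus definite q ∈ S ∨
        ((∃ r ∈ D.supportiveRules q, ∀ a ∈ r.antecedent, plus (main delta) a ∈ S) ∧
          minus definite q.compl ∈ S ∧
          ∀ s ∈ D.rulesFor q.compl,
            (∃ a ∈ s.antecedent, minus (supp delta) a ∈ S) ∨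
            ∃ t ∈ D.supportiveRules q,
              (∀ a ∈ t.antecedent, plus (main delta) a ∈ S) ∧ D.sup t.label s.label)) →
      Infers D delta S (plus (main delta) q)
  | minus_delta (S : Set (Conclusion P)) (q : Literal P) :
      (minus definite q ∈ S ∧
        ((∀ r ∈ D.supportiveRules q, ∃ a ∈ r.antecedent, minus (main delta) a ∈ S) ∨
          plus definite q.compl ∈ S ∨
          ∃ s ∈ D.rulesFor q.compl,
            (∀ a ∈ s.antecedent, plus (supp delta) a ∈ S) ∧
            ∀ t ∈ D.supportiveRules q,
              (∃ a ∈ t.antecedent, minus (main delta) a ∈ S) ∨ ¬ D.sup t.label s.label)) →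
      Infers D delta S (minus (main delta) q)
  | plus_partialStar (S : Set (Conclusion P)) (q : Literal P) :
      (plus definite q ∈ S ∨
        ∃ r ∈ D.supportiveRules q,
          (∀ a ∈ r.antecedent, plus (main partialStar) a ∈ S) ∧
          minus definite q.compl ∈ S ∧
          ∀ s ∈ D.rulesFor q.compl,
            (∃ a ∈ s.antecedent, minus (main partialStar) a ∈ S) ∨ D.sup r.label s.label) →
      Infers D partialStar S (plus (main partialStar) q)
  | minus_partialStar (S : Set (Conclusion P)) (q : Literal P) :
      (minus definite q ∈ S ∧
        ∀ r ∈ D.supportiveRules q,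
          (∃ a ∈ r.antecedent, minus (main partialStar) a ∈ S) ∨
          plus definite q.compl ∈ S ∨
          ∃ s ∈ D.rulesFor q.compl,
            (∀ a ∈ s.antecedent, plus (main partialStar) a ∈ S) ∧ ¬ D.sup r.label s.label) →
      Infers D partialStar S (minus (main partialStar) q)
  | plus_deltaStar (S : Set (Conclusion P)) (q : Literal P) :
      (plus definite q ∈ S ∨
        ∃ r ∈ D.supportiveRules q,
          (∀ a ∈ r.antecedent, plus (main deltaStar) a ∈ S) ∧
          minus definite q.compl ∈ S ∧
          ∀ s ∈ D.rulesFor q.compl,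
            (∃ a ∈ s.antecedent, minus (supp deltaStar) a ∈ S) ∨ D.sup r.label s.label) →
      Infers D deltaStar S (plus (main deltaStar) q)
  | minus_deltaStar (S : Set (Conclusion P)) (q : Literal P) :
      (minus definite q ∈ S ∧
        ∀ r ∈ D.supportiveRules q,
          (∃ a ∈ r.antecedent, minus (main deltaStar) a ∈ S) ∨
          plus definite q.compl ∈ S ∨
          ∃ s ∈ D.rulesFor q.compl,
            (∀ a ∈ s.antecedent, plus (supp deltaStar) a ∈ S) ∧ ¬ D.sup r.label s.label) →
      Infers D deltaStar S (minus (main deltaStar) q)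
  | plus_supp (d : ProofTag) (hd : d = delta ∨ d = deltaStar) (S : Set (Conclusion P))
      (q : Literal P) :
      (plus definite q ∈ S ∨
        ∃ r ∈ D.supportiveRules q,
          (∀ a ∈ r.antecedent, plus (supp d) a ∈ S) ∧
          ∀ s ∈ D.rulesFor q.compl,
            (∃ a ∈ s.antecedent, minus (main d) a ∈ S) ∨ ¬ D.sup s.label r.label) →
      Infers D d S (plus (supp d) q)
  | minus_supp (d : ProofTag) (hd : d = delta ∨ d = deltaStar) (S : Set (Conclusion P))
      (q : Literal P) :
      (minus definite q ∈ S ∧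
        ∀ r ∈ D.supportiveRules q,
          (∃ a ∈ r.antecedent, minus (supp d) a ∈ S) ∨
          ∃ s ∈ D.rulesFor q.compl,
            (∀ a ∈ s.antecedent, plus (main d) a ∈ S) ∧ D.sup s.label r.label) →
      Infers D d S (minus (supp d) q)

/-- A proof in `DL(d)`: a finite sequence of conclusions, each inferred from the earlier ones. -/
def IsProof {P Λ : Type*} (D : DefeasibleTheory P Λ) (d : ProofTag) (prf : List (Conclusion P)) :
    Prop :=
  ∀ (i : ℕ) (hi : i < prf.length), Infers D d {c | c ∈ prf.take i} prf[i]

/-- The conclusion `c` can be proved from `D` in `DL(d)`. -/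
def Derives {P Λ : Type*} (D : DefeasibleTheory P Λ) (d : ProofTag) (c : Conclusion P) : Prop :=
  ∃ prf : List (Conclusion P), IsProof D d prf ∧ c ∈ prf

end ADL

/-! Both sides are least fixed points. The derivable conclusions of `DL(d)` form the least set
closed under `Infers`, and Kunen's consequences are the union of the finite iterates of Fitting's
operator. The theorem compares the two by induction on each side.

From the program to proofs: a set `S` of conclusions is read as an interpretation `conclusionInterp
D d S` of the meta-program, with `+` conclusions giving true atoms and `-` conclusions giving false
ones. If `S` is closed under `Infers`, this interpretation is a prefixed point of Fitting's operator
(`holdsIn_of_clause`, `failsIn_of_clauses`), so it contains every finite iterate. Taking `S` to be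
the derivable conclusions gives `kunenEntails_sound`. Under the free annotation, the atoms with
subscript `d` and tag `free` or `d` depend only on one another and on auxiliary atoms, so all other
tags can be ignored.

From proofs to the program: the set `Realized D d` of conclusions whose counterparts are Kunen
consequences is closed under `Infers` (`realized_of_infers`), hence contains every derivable
conclusion. The difficulty is falsity. One finite stage must refute all clauses for an atom, and
these are infinitely many, because labels and bodies are instantiated freely. From stage 3 on, the
atoms that describe the theory are all decided (`eventually_fittingIter_base`), which refutes every
instance that does not come from an actual rule. Finitely many rules remain, and they have a common
stage.

Finiteness of the set of rules is thus used twice: there, and to make derivability by finite proofs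
closed under inferences with universal premises. Consistency of the proof system is nowhere needed.
-/

open Filter

namespace ADL

/-! ## Finitary predicates and proofs -/

/-- A predicate on sets is finitary if it is monotone and, whenever it holds, it is forced by a
finite subset. -/
def Finitary {α : Type*} (F : Set α → Prop) : Prop :=
  ∀ S, F S → ∃ T : Set α, T.Finite ∧ T ⊆ S ∧ ∀ U, T ⊆ U → F U

namespace Finitary

variable {α β : Type*} {F G : Set α → Prop}

theorem const (p : Prop) : Finitary fun _ : Set α => p :=
  fun S h => ⟨∅, Set.finite_empty, Set.empty_subset S, fun _ _ => h⟩

theorem mem (c : α) : Finitary fun S : Set α => c ∈ S :=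
  fun _ h => ⟨{c}, Set.finite_singleton c, Set.singleton_subset_iff.2 h,
    fun _ hU => hU (Set.mem_singleton c)⟩

theorem and (hF : Finitary F) (hG : Finitary G) : Finitary fun S => F S ∧ G S := by
  rintro S ⟨h1, h2⟩
  obtain ⟨T, hT, hTS, hTU⟩ := hF S h1
  obtain ⟨T', hT', hTS', hTU'⟩ := hG S h2
  exact ⟨T ∪ T', hT.union hT', Set.union_subset hTS hTS', fun U hU =>
    ⟨hTU U (Set.subset_union_left.trans hU), hTU' U (Set.subset_union_right.trans hU)⟩⟩

theorem or (hF : Finitary F) (hG : Finitary G) : Finitary fun S => F S ∨ G S := by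
  rintro S (h | h)
  · obtain ⟨T, hT, hTS, hTU⟩ := hF S h
    exact ⟨T, hT, hTS, fun U hU => Or.inl (hTU U hU)⟩
  · obtain ⟨T, hT, hTS, hTU⟩ := hG S h
    exact ⟨T, hT, hTS, fun U hU => Or.inr (hTU U hU)⟩

theorem bex {s : Set β} {F : β → Set α → Prop} (hF : ∀ b, Finitary (F b)) :
    Finitary fun S => ∃ b ∈ s, F b S := by
  rintro S ⟨b, hb, h⟩
  obtain ⟨T, hT, hTS, hTU⟩ := hF b S h
  exact ⟨T, hT, hTS, fun U hU => ⟨b, hb, hTU U hU⟩⟩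

/-- The union of the witnesses stays finite only because the index set is finite. This is where
finiteness of rule sets and of bodies enters. -/
theorem ball {s : Set β} (hs : s.Finite) {F : β → Set α → Prop} (hF : ∀ b, Finitary (F b)) :
    Finitary fun S => ∀ b ∈ s, F b S := by
  intro S h
  choose T hT hTS hTU using fun b : s => hF b S (h b b.2)
  have := hs.to_subtype
  exact ⟨⋃ b, T b, Set.finite_iUnion hT, Set.iUnion_subset hTS, fun U hU b hb =>
    hTU ⟨b, hb⟩ U ((Set.subset_iUnion T ⟨b, hb⟩).trans hU)⟩

theorem bexList {l : List β} {F : β → Set α → Prop} (hF : ∀ b, Finitary (F b)) :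
    Finitary fun S => ∃ b ∈ l, F b S :=
  bex (s := {b | b ∈ l}) hF

theorem ballList {l : List β} {F : β → Set α → Prop} (hF : ∀ b, Finitary (F b)) :
    Finitary fun S => ∀ b ∈ l, F b S :=
  ball (s := {b | b ∈ l}) l.finite_toSet hF

end Finitary

section Proofs

variable {P Λ B : Type*}

theorem Theory.finite_supportiveRules (D : Theory P Λ B) (q : Literal P) :
    (D.supportiveRules q).Finite :=
  D.finite_rules.subset fun _ h => h.1

theorem Theory.finite_strictRules (D : Theory P Λ B) (q : Literal P) :
    (D.strictRules q).Finite :=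
  D.finite_rules.subset fun _ h => h.1

theorem Theory.finite_rulesFor (D : Theory P Λ B) (q : Literal P) :
    (D.rulesFor q).Finite :=
  D.finite_rules.subset fun _ h => h.1

/-- Every premise is built from membership statements and constants by conjunction, disjunction and
quantifiers over rules or body literals. Negated memberships never occur, and the universal
quantifiers range over finite sets. -/
theorem finitary_infers (D : DefeasibleTheory P Λ) (d : ProofTag) (c : Conclusion P) :
    Finitary fun S => Infers D d S c := by
  have key : ∀ F : Set (Conclusion P) → Prop, Finitary F → (∀ S, F S → Infers D d S c) →
      ∀ S, F S → ∃ T : Set (Conclusion P), T.Finite ∧ T ⊆ S ∧ ∀ U, T ⊆ U → Infers D d U c := by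
    intro F hF hI S hS
    obtain ⟨T, hT, hTS, hTU⟩ := hF S hS
    exact ⟨T, hT, hTS, fun U hU => hI U (hTU U hU)⟩
  have h1 := D.finite_supportiveRules
  have h2 := D.finite_strictRules
  have h3 := D.finite_rulesFor
  intro S h
  cases h with
  | plus_definite _ _ q h =>
    refine key _ ?_ (fun S => Infers.plus_definite d S q) S h
    exact (Finitary.const _).or (.bex fun _ => .ballList fun _ => .mem _)
  | minus_definite _ _ q h =>
    refine key _ ?_ (fun S => Infers.minus_definite d S q) S h
    exact (Finitary.const _).and (.ball (h2 _) fun _ => .bexList fun _ => .mem _)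
  | plus_partial _ q h =>
    refine key _ ?_ (fun S => Infers.plus_partial S q) S h
    exact (Finitary.mem _).or (.and (.bex fun _ => .ballList fun _ => .mem _)
      (.and (.mem _) (.ball (h3 _) fun _ => .or (.bexList fun _ => .mem _)
        (.bex fun _ => .and (.ballList fun _ => .mem _) (.const _)))))
  | minus_partial _ q h =>
    refine key _ ?_ (fun S => Infers.minus_partial S q) S h
    exact (Finitary.mem _).and (.or (.ball (h1 _) fun _ => .bexList fun _ => .mem _)
      (.or (.mem _) (.bex fun _ => .and (.ballList fun _ => .mem _)
        (.ball (h1 _) fun _ => .or (.bexList fun _ => .mem _) (.const _)))))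
  | plus_delta _ q h =>
    refine key _ ?_ (fun S => Infers.plus_delta S q) S h
    exact (Finitary.mem _).or (.and (.bex fun _ => .ballList fun _ => .mem _)
      (.and (.mem _) (.ball (h3 _) fun _ => .or (.bexList fun _ => .mem _)
        (.bex fun _ => .and (.ballList fun _ => .mem _) (.const _)))))
  | minus_delta _ q h =>
    refine key _ ?_ (fun S => Infers.minus_delta S q) S h
    exact (Finitary.mem _).and (.or (.ball (h1 _) fun _ => .bexList fun _ => .mem _)
      (.or (.mem _) (.bex fun _ => .and (.ballList fun _ => .mem _)
        (.ball (h1 _) fun _ => .or (.bexList fun _ => .mem _) (.const _)))))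
  | plus_partialStar _ q h =>
    refine key _ ?_ (fun S => Infers.plus_partialStar S q) S h
    exact (Finitary.mem _).or (.bex fun _ => .and (.ballList fun _ => .mem _)
      (.and (.mem _) (.ball (h3 _) fun _ => .or (.bexList fun _ => .mem _) (.const _))))
  | minus_partialStar _ q h =>
    refine key _ ?_ (fun S => Infers.minus_partialStar S q) S h
    exact (Finitary.mem _).and (.ball (h1 _) fun _ => .or (.bexList fun _ => .mem _)
      (.or (.mem _) (.bex fun _ => .and (.ballList fun _ => .mem _) (.const _))))
  | plus_deltaStar _ q h =>
    refine key _ ?_ (fun S => Infers.plus_deltaStar S q) S h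
    exact (Finitary.mem _).or (.bex fun _ => .and (.ballList fun _ => .mem _)
      (.and (.mem _) (.ball (h3 _) fun _ => .or (.bexList fun _ => .mem _) (.const _))))
  | minus_deltaStar _ q h =>
    refine key _ ?_ (fun S => Infers.minus_deltaStar S q) S h
    exact (Finitary.mem _).and (.ball (h1 _) fun _ => .or (.bexList fun _ => .mem _)
      (.or (.mem _) (.bex fun _ => .and (.ballList fun _ => .mem _) (.const _))))
  | plus_supp _ hd _ q h =>
    refine key _ ?_ (fun S => Infers.plus_supp d hd S q) S h
    exact (Finitary.mem _).or (.bex fun _ => .and (.ballList fun _ => .mem _)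
      (.ball (h3 _) fun _ => .or (.bexList fun _ => .mem _) (.const _)))
  | minus_supp _ hd _ q h =>
    refine key _ ?_ (fun S => Infers.minus_supp d hd S q) S h
    exact (Finitary.mem _).and (.ball (h1 _) fun _ => .or (.bexList fun _ => .mem _)
      (.bex fun _ => .and (.ballList fun _ => .mem _) (.const _)))

/-! ### Derivability as the least set closed under the inference rules. -/

variable {D : DefeasibleTheory P Λ} {d : ProofTag}

theorem Infers.mono {S U : Set (Conclusion P)} {c : Conclusion P} (h : Infers D d S c)
    (hSU : S ⊆ U) : Infers D d U c := by
  obtain ⟨T, -, hTS, hTU⟩ := finitary_infers D d c S h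
  exact hTU U (hTS.trans hSU)

/-- Placing a proof after another only enlarges the set of earlier conclusions, which is harmless by
monotonicity of inference. -/
theorem IsProof.append {p q : List (Conclusion P)} (hp : IsProof D d p) (hq : IsProof D d q) :
    IsProof D d (p ++ q) := by
  intro i hi
  by_cases h : i < p.length
  · rw [List.getElem_append_left h]
    refine (hp i h).mono fun c hc => ?_
    simp only [Set.mem_ofPred_eq, List.take_append, List.mem_append] at hc ⊢
    exact Or.inl hc
  · rw [List.getElem_append_right (not_lt.1 h)]
    refine (hq (i - p.length) (by rw [List.length_append] at hi; omega)).mono fun c hc => ?_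
    simp only [Set.mem_ofPred_eq, List.take_append, List.mem_append] at hc ⊢
    exact Or.inr hc

theorem IsProof.concat {p : List (Conclusion P)} (hp : IsProof D d p) {c : Conclusion P}
    (hc : Infers D d {a | a ∈ p} c) : IsProof D d (p ++ [c]) := by
  intro i hi
  by_cases h : i < p.length
  · rw [List.getElem_append_left h, List.take_append_of_le_length h.le]
    exact hp i h
  · have : i = p.length := by simp at hi; omega
    subst this
    simpa using hc

theorem exists_isProof_of_finite {T : Set (Conclusion P)} (hT : T.Finite)
    (h : ∀ c ∈ T, Derives D d c) : ∃ p, IsProof D d p ∧ ∀ c ∈ T, c ∈ p := by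
  induction T, hT using Set.Finite.induction_on with
  | empty => exact ⟨[], fun i hi => absurd hi (by simp), by simp⟩
  | insert _ _ ih =>
    obtain ⟨p, hp, hpT⟩ := ih fun c hc => h c (Set.mem_insert_of_mem _ hc)
    obtain ⟨p', hp', hc⟩ := h _ (Set.mem_insert _ _)
    refine ⟨p ++ p', hp.append hp', ?_⟩
    rintro c (rfl | hcT)
    · exact List.mem_append_right _ hc
    · exact List.mem_append_left _ (hpT c hcT)

/-- The derivable conclusions are closed under the inference rules. -/
theorem Derives.of_infers {c : Conclusion P} (h : Infers D d {a | Derives D d a} c) :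
    Derives D d c := by
  -- The inference uses only a finite set `T` of derivable conclusions, so their proofs can be
  -- concatenated into one finite proof and `c` appended to it.
  obtain ⟨T, hT, hTS, hTU⟩ := finitary_infers D d c _ h
  obtain ⟨p, hp, hpT⟩ := exists_isProof_of_finite hT hTS
  exact ⟨p ++ [c], hp.concat (hTU _ hpT), by simp⟩

/-- The derivable conclusions are contained in every set closed under the inference rules. -/
theorem Derives.mem_of_closed {S : Set (Conclusion P)} (hS : ∀ c, Infers D d S c → c ∈ S)
    {c : Conclusion P} (h : Derives D d c) : c ∈ S := by
  obtain ⟨p, hp, hc⟩ := h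
  have key : ∀ i (hi : i < p.length), p[i] ∈ S := by
    intro i
    induction i using Nat.strong_induction_on with
    | _ i ih =>
      intro hi
      refine hS _ ((hp i hi).mono fun a ha => ?_)
      obtain ⟨j, hj, rfl⟩ := List.mem_take_iff_getElem.1 ha
      exact ih j (by omega) _
  obtain ⟨i, hi, rfl⟩ := List.getElem_of_mem hc
  exact key i hi

end Proofs

/-! ## Iterates of Fitting's operator -/

section Fitting

variable {A : Type*} {Pr : Program A}

theorem fitting_mono {I J : PartialInterp A} (ht : I.trueSet ⊆ J.trueSet)
    (hf : I.falseSet ⊆ J.falseSet) :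
    (fitting Pr I).trueSet ⊆ (fitting Pr J).trueSet ∧
      (fitting Pr I).falseSet ⊆ (fitting Pr J).falseSet := by
  have h1 : ∀ L : ProgLit A, L.IsTrue I → L.IsTrue J := by
    rintro (a | a) h
    exacts [ht h, hf h]
  have h2 : ∀ L : ProgLit A, L.IsFalse I → L.IsFalse J := by
    rintro (a | a) h
    exacts [hf h, ht h]
  constructor
  · rintro a ⟨c, hc, rfl, hb⟩
    exact ⟨c, hc, rfl, fun L hL => h1 L (hb L hL)⟩
  · intro a ha c hc hca
    obtain ⟨L, hL, hLf⟩ := ha c hc hca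
    exact ⟨L, hL, h2 L hLf⟩

theorem fittingIter_subset_succ (n : ℕ) :
    (fittingIter Pr n).trueSet ⊆ (fittingIter Pr (n + 1)).trueSet ∧
      (fittingIter Pr n).falseSet ⊆ (fittingIter Pr (n + 1)).falseSet := by
  induction n with
  | zero => exact ⟨Set.empty_subset _, Set.empty_subset _⟩
  | succ n ih => exact fitting_mono ih.1 ih.2

/-- Fixed-point induction. The sets of `J` may overlap: an atom that is both true and false in `J`
merely imposes no constraint. -/
theorem fittingIter_subset_of_prefixed {J : PartialInterp A}
    (ht : (fitting Pr J).trueSet ⊆ J.trueSet) (hf : (fitting Pr J).falseSet ⊆ J.falseSet) (n : ℕ) :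
    (fittingIter Pr n).trueSet ⊆ J.trueSet ∧ (fittingIter Pr n).falseSet ⊆ J.falseSet := by
  induction n with
  | zero => exact ⟨Set.empty_subset _, Set.empty_subset _⟩
  | succ n ih =>
    have := fitting_mono (Pr := Pr) ih.1 ih.2
    exact ⟨this.1.trans ht, this.2.trans hf⟩

/-- The iterates increase, so a literal stays true once it is true. Stated with `atTop`, finitely
many consequences can be moved to a common stage by intersecting filter sets. -/
theorem KunenEntails.eventually {L : ProgLit A} (h : KunenEntails Pr L) :
    ∀ᶠ n in atTop, L.IsTrue (fittingIter Pr n) := by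
  obtain ⟨n, hn⟩ := h
  refine eventually_atTop.2 ⟨n, fun m hm => ?_⟩
  induction m, hm using Nat.le_induction with
  | base => exact hn
  | succ m _ ih =>
    cases L with
    | pos a => exact (fittingIter_subset_succ m).1 ih
    | not a => exact (fittingIter_subset_succ m).2 ih

theorem KunenEntails.of_clause {c : Clause A} (hc : c ∈ Pr)
    (h : ∀ L ∈ c.body, KunenEntails Pr L) : KunenEntails Pr (.pos c.head) := by
  have : ∀ᶠ n in atTop, ∀ L ∈ {L | L ∈ c.body}, L.IsTrue (fittingIter Pr n) :=
    (eventually_all_finite c.body.finite_toSet).2 fun L hL => (h L hL).eventually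
  obtain ⟨n, hn⟩ := this.exists
  exact ⟨n + 1, c, hc, rfl, hn⟩

/-- A single stage has to refute all clauses at once. Refuting each clause at a stage of its own
would not suffice, since the iteration stops at ω. -/
theorem KunenEntails.not_of_eventually {a : A}
    (h : ∀ᶠ n in atTop, ∀ c ∈ Pr, c.head = a → ∃ L ∈ c.body, L.IsFalse (fittingIter Pr n)) :
    KunenEntails Pr (.not a) := by
  obtain ⟨n, hn⟩ := h.exists
  exact ⟨n + 1, hn⟩

end Fitting

/-! ## Uniform description of the inference rules -/

section Uniform

variable {P Λ : Type*}

/-- The tag `τ` of the conclusions on attacking rules. -/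
def attackTag : ProofTag → ConclTag
  | .partialTag => .main .partialTag
  | .partialStar => .main .partialStar
  | .delta => .supp .delta
  | .deltaStar => .supp .deltaStar

/-- Superiority restricted to labels of rules of the theory. -/
def Theory.SupLabels (D : DefeasibleTheory P Λ) (l m : Λ) : Prop :=
  ∃ r ∈ D.rules, ∃ s ∈ D.rules, r.label = l ∧ s.label = m ∧ D.sup l m

theorem Theory.supLabels_iff (D : DefeasibleTheory P Λ) {r s : Rule P Λ (Literal P)}
    (hr : r ∈ D.rules) (hs : s ∈ D.rules) :
    D.SupLabels r.label s.label ↔ D.sup r.label s.label :=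
  ⟨fun ⟨_, _, _, _, _, _, h⟩ => h, fun h => ⟨r, hr, s, hs, rfl, rfl, h⟩⟩

/-- Given `S`, an attack by the rule labelled `m` on the rule labelled `l` with head `q` is
defeated. -/
def Defeats (D : DefeasibleTheory P Λ) (d : ProofTag) (S : Set (Conclusion P)) (l m : Λ)
    (q : Literal P) : Prop :=
  ((d = .partialTag ∨ d = .delta) ∧ ∃ t ∈ D.supportiveRules q,
      (∀ a ∈ t.antecedent, .plus (.main d) a ∈ S) ∧ D.SupLabels t.label m) ∨
    ((d = .partialStar ∨ d = .deltaStar) ∧ D.SupLabels l m)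

/-- Given `S`, an attack by the rule labelled `m` on the rule labelled `l` with head `q` cannot be
defeated. -/
def FailsToDefeat (D : DefeasibleTheory P Λ) (d : ProofTag) (S : Set (Conclusion P)) (l m : Λ)
    (q : Literal P) : Prop :=
  ((d = .partialTag ∨ d = .delta) → ∀ t ∈ D.supportiveRules q,
      (∃ a ∈ t.antecedent, .minus (.main d) a ∈ S) ∨ ¬ D.SupLabels t.label m) ∧
    ((d = .partialStar ∨ d = .deltaStar) → ¬ D.SupLabels l m)

variable (D : DefeasibleTheory P Λ) (d : ProofTag) (S : Set (Conclusion P)) (q : Literal P)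

theorem infers_plus_definite_iff : Infers D d S (.plus .definite q) ↔
    q ∈ D.facts ∨ ∃ r ∈ D.strictRules q, ∀ a ∈ r.antecedent, .plus .definite a ∈ S :=
  ⟨fun h => by cases h; assumption, .plus_definite d S q⟩

theorem infers_minus_definite_iff : Infers D d S (.minus .definite q) ↔
    q ∉ D.facts ∧ ∀ r ∈ D.strictRules q, ∃ a ∈ r.antecedent, .minus .definite a ∈ S :=
  ⟨fun h => by cases h; assumption, .minus_definite d S q⟩

/-- The four systems differ only in the tag used for attackers and in who may answer an attack, any
team member or just the rule `r` itself. In the team systems the condition on attackers does not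
depend on `r`, so it can be moved under the quantifier over `r`. Restricting superiority to labels
of rules changes nothing, as only rules are compared. -/
theorem infers_plus_main_iff : Infers D d S (.plus (.main d) q) ↔
    (.plus .definite q ∈ S ∨ ∃ r ∈ D.supportiveRules q,
      (∀ a ∈ r.antecedent, .plus (.main d) a ∈ S) ∧ .minus .definite q.compl ∈ S ∧
      ∀ s ∈ D.rulesFor q.compl, (∃ a ∈ s.antecedent, .minus (attackTag d) a ∈ S) ∨
        Defeats D d S r.label s.label q) := by
  have e : ∀ r ∈ D.supportiveRules q, ∀ s ∈ D.rulesFor q.compl,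
      (D.SupLabels r.label s.label ↔ D.sup r.label s.label) := fun r hr s hs =>
    D.supLabels_iff hr.1 hs.1
  have team : ∀ s ∈ D.rulesFor q.compl,
      ((∃ t ∈ D.supportiveRules q, (∀ a ∈ t.antecedent, .plus (.main d) a ∈ S) ∧
          D.SupLabels t.label s.label) ↔
        ∃ t ∈ D.supportiveRules q, (∀ a ∈ t.antecedent, .plus (.main d) a ∈ S) ∧
          D.sup t.label s.label) := fun s hs =>
    exists_congr fun t => and_congr_right fun ht => and_congr_right fun _ => e t ht s hs
  constructor
  · intro h
    cases h with
    | plus_partial _ _ h | plus_delta _ _ h =>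
      refine h.imp_right ?_
      rintro ⟨⟨r, hr, hra⟩, hq, hs⟩
      refine ⟨r, hr, hra, hq, fun s hsq => (hs s hsq).imp_right fun h => ?_⟩
      exact Or.inl ⟨by simp, (team s hsq).2 h⟩
    | plus_partialStar _ _ h | plus_deltaStar _ _ h =>
      refine h.imp_right ?_
      rintro ⟨r, hr, hra, hq, hs⟩
      refine ⟨r, hr, hra, hq, fun s hsq => (hs s hsq).imp_right fun h => ?_⟩
      exact Or.inr ⟨by simp, (e r hr s hsq).2 h⟩
  · intro h
    cases d
    case partialTag =>
      refine .plus_partial S q (h.imp_right ?_)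
      rintro ⟨r, hr, hra, hq, hs⟩
      refine ⟨⟨r, hr, hra⟩, hq, fun s hsq => (hs s hsq).imp_right fun h => (team s hsq).1 ?_⟩
      simpa [Defeats] using h
    case delta =>
      refine .plus_delta S q (h.imp_right ?_)
      rintro ⟨r, hr, hra, hq, hs⟩
      refine ⟨⟨r, hr, hra⟩, hq, fun s hsq => (hs s hsq).imp_right fun h => (team s hsq).1 ?_⟩
      simpa [Defeats] using h
    case partialStar =>
      refine .plus_partialStar S q (h.imp_right ?_)
      rintro ⟨r, hr, hra, hq, hs⟩
      refine ⟨r, hr, hra, hq, fun s hsq => (hs s hsq).imp_right fun h => (e r hr s hsq).1 ?_⟩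
      simpa [Defeats] using h
    case deltaStar =>
      refine .plus_deltaStar S q (h.imp_right ?_)
      rintro ⟨r, hr, hra, hq, hs⟩
      refine ⟨r, hr, hra, hq, fun s hsq => (hs s hsq).imp_right fun h => (e r hr s hsq).1 ?_⟩
      simpa [Defeats] using h

/-- The dual form. It quantifies over `r` first, as the clauses for `defeasibly` and `overruled` do,
including in the team systems, where the inference rule states the alternatives globally. -/
theorem infers_minus_main_iff : Infers D d S (.minus (.main d) q) ↔
    (.minus .definite q ∈ S ∧ ∀ r ∈ D.supportiveRules q,
      (∃ a ∈ r.antecedent, .minus (.main d) a ∈ S) ∨ .plus .definite q.compl ∈ S ∨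
      ∃ s ∈ D.rulesFor q.compl, (∀ a ∈ s.antecedent, .plus (attackTag d) a ∈ S) ∧
        FailsToDefeat D d S r.label s.label q) := by
  have e : ∀ r ∈ D.supportiveRules q, ∀ s ∈ D.rulesFor q.compl,
      (D.SupLabels r.label s.label ↔ D.sup r.label s.label) := fun r hr s hs =>
    D.supLabels_iff hr.1 hs.1
  have team : ∀ s ∈ D.rulesFor q.compl,
      ((∀ t ∈ D.supportiveRules q, (∃ a ∈ t.antecedent, .minus (.main d) a ∈ S) ∨
          ¬ D.SupLabels t.label s.label) ↔
        ∀ t ∈ D.supportiveRules q, (∃ a ∈ t.antecedent, .minus (.main d) a ∈ S) ∨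
          ¬ D.sup t.label s.label) := fun s hs =>
    forall_congr' fun t => forall_congr' fun ht => or_congr_right (not_congr (e t ht s hs))
  -- For team defeat the last two alternatives do not mention `r`, so by excluded middle they can be
  -- pulled out of the quantifier.
  have split : ∀ {A : Rule P Λ (Literal P) → Prop} {B C : Prop},
      (∀ r ∈ D.supportiveRules q, A r ∨ B ∨ C) →
        (∀ r ∈ D.supportiveRules q, A r) ∨ B ∨ C := by
    intro A B C h
    by_cases hBC : B ∨ C
    · exact Or.inr hBC
    · exact Or.inl fun r hr => (h r hr).resolve_right hBC
  constructor
  · intro h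
    cases h with
    | minus_partial _ _ h | minus_delta _ _ h =>
      refine ⟨h.1, fun r hr => ?_⟩
      rcases h.2 with h | h | ⟨s, hs, hsa, ht⟩
      · exact Or.inl (h r hr)
      · exact Or.inr (Or.inl h)
      · exact Or.inr (Or.inr ⟨s, hs, hsa, fun _ => (team s hs).2 ht, by simp⟩)
    | minus_partialStar _ _ h | minus_deltaStar _ _ h =>
      refine ⟨h.1, fun r hr => (h.2 r hr).imp_right (Or.imp_right ?_)⟩
      rintro ⟨s, hs, hsa, ht⟩
      exact ⟨s, hs, hsa, by simp, fun _ => (not_congr (e r hr s hs)).2 ht⟩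
  · rintro ⟨h1, h2⟩
    cases d
    case partialTag =>
      refine .minus_partial S q ⟨h1, split fun r hr => ?_⟩
      refine (h2 r hr).imp_right (Or.imp_right ?_)
      rintro ⟨s, hs, hsa, ht⟩
      exact ⟨s, hs, hsa, (team s hs).1 (ht.1 (by simp))⟩
    case delta =>
      refine .minus_delta S q ⟨h1, split fun r hr => ?_⟩
      refine (h2 r hr).imp_right (Or.imp_right ?_)
      rintro ⟨s, hs, hsa, ht⟩
      exact ⟨s, hs, hsa, (team s hs).1 (ht.1 (by simp))⟩
    case partialStar =>
      refine .minus_partialStar S q ⟨h1, fun r hr => ?_⟩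
      refine (h2 r hr).imp_right (Or.imp_right ?_)
      rintro ⟨s, hs, hsa, ht⟩
      exact ⟨s, hs, hsa, (not_congr (e r hr s hs)).1 (ht.2 (by simp))⟩
    case deltaStar =>
      refine .minus_deltaStar S q ⟨h1, fun r hr => ?_⟩
      refine (h2 r hr).imp_right (Or.imp_right ?_)
      rintro ⟨s, hs, hsa, ht⟩
      exact ⟨s, hs, hsa, (not_congr (e r hr s hs)).1 (ht.2 (by simp))⟩

theorem infers_plus_supp_iff (hd : d = .delta ∨ d = .deltaStar) :
    Infers D d S (.plus (.supp d) q) ↔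
    (.plus .definite q ∈ S ∨ ∃ r ∈ D.supportiveRules q,
      (∀ a ∈ r.antecedent, .plus (.supp d) a ∈ S) ∧
      ∀ s ∈ D.rulesFor q.compl, (∃ a ∈ s.antecedent, .minus (.main d) a ∈ S) ∨
        ¬ D.SupLabels s.label r.label) := by
  have e : ∀ r ∈ D.supportiveRules q, ∀ s ∈ D.rulesFor q.compl,
      (D.SupLabels s.label r.label ↔ D.sup s.label r.label) := fun r hr s hs =>
    D.supLabels_iff hs.1 hr.1
  constructor
  · intro h
    cases h with
    | plus_supp _ _ _ _ h =>
      refine h.imp_right ?_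
      rintro ⟨r, hr, hra, hs⟩
      exact ⟨r, hr, hra, fun s hsq => (hs s hsq).imp_right (not_congr (e r hr s hsq)).2⟩
  · intro h
    refine .plus_supp d hd S q (h.imp_right ?_)
    rintro ⟨r, hr, hra, hs⟩
    exact ⟨r, hr, hra, fun s hsq => (hs s hsq).imp_right (not_congr (e r hr s hsq)).1⟩

theorem infers_minus_supp_iff (hd : d = .delta ∨ d = .deltaStar) :
    Infers D d S (.minus (.supp d) q) ↔
    (.minus .definite q ∈ S ∧ ∀ r ∈ D.supportiveRules q,
      (∃ a ∈ r.antecedent, .minus (.supp d) a ∈ S) ∨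
      ∃ s ∈ D.rulesFor q.compl, (∀ a ∈ s.antecedent, .plus (.main d) a ∈ S) ∧
        D.SupLabels s.label r.label) := by
  have e : ∀ r ∈ D.supportiveRules q, ∀ s ∈ D.rulesFor q.compl,
      (D.SupLabels s.label r.label ↔ D.sup s.label r.label) := fun r hr s hs =>
    D.supLabels_iff hs.1 hr.1
  constructor
  · intro h
    cases h with
    | minus_supp _ _ _ _ h =>
      refine ⟨h.1, fun r hr => (h.2 r hr).imp_right ?_⟩
      rintro ⟨s, hs, hsa, ht⟩
      exact ⟨s, hs, hsa, (e r hr s hs).2 ht⟩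
  · rintro ⟨h1, h2⟩
    refine .minus_supp d hd S q ⟨h1, fun r hr => (h2 r hr).imp_right ?_⟩
    rintro ⟨s, hs, hsa, ht⟩
    exact ⟨s, hs, hsa, (e r hr s hs).1 ht⟩

end Uniform

/-! ## The freely annotated theory -/

section Free

variable {P Λ : Type*}

theorem Literal.compl_compl (q : Literal P) : q.compl.compl = q := by
  cases q <;> rfl

/-- The body that represents the antecedent of an unannotated rule. -/
def freeBody (b : List (Literal P)) : List (BodyExpr P) :=
  b.map fun q => BodyExpr.lit ⟨Tag.free, q⟩

theorem Rule.annotate_free (r : Rule P Λ (Literal P)) :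
    r.annotate (freeAnnotation Λ) = match r with
      | .strict l b h => .strict l b h
      | .defeasible l b h => .defeasible l (freeBody b) h
      | .defeater l b h => .defeater l (freeBody b) h := by
  have key : ∀ (l : Λ) (b : List (Literal P)),
      (b.mapIdx fun i q => BodyExpr.lit ⟨freeAnnotation Λ l i, q⟩) = freeBody b := by
    intro l b
    apply List.ext_getElem <;> simp [freeBody, freeAnnotation]
  cases r <;> simp [Rule.annotate, key]

variable (D : DefeasibleTheory P Λ)

theorem strict_mem_annotate_free {l : Λ} {b : List (Literal P)} {p : Literal P} :
    Rule.strict l b p ∈ (D.annotate (freeAnnotation Λ)).rules ↔ Rule.strict l b p ∈ D.rules := by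
  constructor
  · rintro ⟨r, hr, h⟩
    rw [Rule.annotate_free] at h
    cases r <;> simp_all
  · exact fun h => ⟨_, h, rfl⟩

theorem defeasible_mem_annotate_free {l : Λ} {b : List (BodyExpr P)} {p : Literal P} :
    Rule.defeasible l b p ∈ (D.annotate (freeAnnotation Λ)).rules ↔
      ∃ b', b = freeBody b' ∧ Rule.defeasible l b' p ∈ D.rules := by
  constructor
  · rintro ⟨r, hr, h⟩
    rw [Rule.annotate_free] at h
    cases r <;> simp at h
    obtain ⟨rfl, rfl, rfl⟩ := h
    exact ⟨_, rfl, hr⟩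
  · rintro ⟨b', rfl, h⟩
    exact ⟨_, h, Rule.annotate_free _⟩

theorem defeater_mem_annotate_free {l : Λ} {b : List (BodyExpr P)} {p : Literal P} :
    Rule.defeater l b p ∈ (D.annotate (freeAnnotation Λ)).rules ↔
      ∃ b', b = freeBody b' ∧ Rule.defeater l b' p ∈ D.rules := by
  constructor
  · rintro ⟨r, hr, h⟩
    rw [Rule.annotate_free] at h
    cases r <;> simp at h
    obtain ⟨rfl, rfl, rfl⟩ := h
    exact ⟨_, rfl, hr⟩
  · rintro ⟨b', rfl, h⟩
    exact ⟨_, h, Rule.annotate_free _⟩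

/-- The meta-program of the freely annotated theory. -/
abbrev freeProgram : Program (MetaAtom P Λ) := metaProgram (D.annotate (freeAnnotation Λ))

/-! ### Atoms of the meta-program that do not depend on derivability. -/

/-- The intended meaning of the atoms that represent the theory and classify tags and rules; other
atoms do not hold. -/
def Represents : MetaAtom P Λ → Prop
  | .fact p => p ∈ D.facts
  | .strict r p b => Rule.strict r b p ∈ D.rules
  | .defeasible r p b => ∃ b', b = freeBody b' ∧ Rule.defeasible r b' p ∈ D.rules
  | .defeater r p b => ∃ b', b = freeBody b' ∧ Rule.defeater r b' p ∈ D.rules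
  | .sup r s => D.SupLabels r s
  | .team Z => ∃ d, (d = .partialTag ∨ d = .delta) ∧ Z = .proof d
  | .indiv Z => ∃ d, (d = .partialStar ∨ d = .deltaStar) ∧ Z = .proof d
  | .ambiguityBlocking Z => ∃ d, (d = .partialTag ∨ d = .partialStar) ∧ Z = .proof d
  | .ambiguityPropagating Z => ∃ d, (d = .delta ∨ d = .deltaStar) ∧ Z = .proof d
  | .proofTag Z => ∃ d, Z = .proof d
  | .supportiveRule l p b => ∃ r ∈ D.supportiveRules p, r.label = l ∧ b = freeBody r.antecedent
  | .rule l p b => ∃ r ∈ D.rulesFor p, r.label = l ∧ b = freeBody r.antecedent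
  | _ => False

/-- The atoms whose meaning does not depend on derivability. -/
def IsBase : MetaAtom P Λ → Prop
  | .definitely _ | .defeasibly _ _ | .overruled _ _ _ | .defeated _ _ _ _ | .supported _ _
  | .beaten _ _ _ => False
  | _ => True

/-- The depth of the dependence of a base atom on other base atoms. -/
def baseRank : MetaAtom P Λ → ℕ
  | .rule _ _ _ => 2
  | .supportiveRule _ _ _ => 1
  | _ => 0

variable {D}

/-- The base atoms form a positive, stratified subprogram: their clauses call only base atoms of
smaller rank. Its clauses preserve the intended meaning. -/
theorem base_of_clause {c : Clause (MetaAtom P Λ)} (hc : c ∈ freeProgram D) (ha : IsBase c.head) :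
    (∀ L ∈ c.body, ∃ b, L = .pos b ∧ IsBase b ∧ baseRank b < baseRank c.head) ∧
      ((∀ b, .pos b ∈ c.body → Represents D b) → Represents D c.head) := by
  cases hc
  case fact p h => exact ⟨by simp, fun _ => h⟩
  case strict h => exact ⟨by simp, fun _ => (strict_mem_annotate_free D).1 h⟩
  case defeasible h => exact ⟨by simp, fun _ => (defeasible_mem_annotate_free D).1 h⟩
  case defeater h => exact ⟨by simp, fun _ => (defeater_mem_annotate_free D).1 h⟩
  case sup r s hr hs h =>
    obtain ⟨r, hr, rfl⟩ := hr
    obtain ⟨s, hs, rfl⟩ := hs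
    exact ⟨by simp, fun _ =>
      ⟨r, hr, s, hs, (Rule.label_annotate _ r).symm, (Rule.label_annotate _ s).symm, h⟩⟩
  case supportive_strict r p b =>
    refine ⟨by simp [IsBase, baseRank], fun hb => ?_⟩
    have h : Rule.strict r b p ∈ D.rules := hb (.strict r p b) (List.mem_singleton_self _)
    exact ⟨.strict r b p, ⟨h, trivial, rfl⟩, rfl, rfl⟩
  case supportive_defeasible r p b =>
    refine ⟨by simp [IsBase, baseRank], fun hb => ?_⟩
    obtain ⟨b', rfl, h⟩ := hb (.defeasible r p b) (List.mem_singleton_self _)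
    exact ⟨.defeasible r b' p, ⟨h, trivial, rfl⟩, rfl, rfl⟩
  case rule_supportive r p b =>
    refine ⟨by simp [IsBase, baseRank], fun hb => ?_⟩
    obtain ⟨ρ, h, h'⟩ := hb (.supportiveRule r p b) (List.mem_singleton_self _)
    exact ⟨ρ, ⟨h.1, h.2.2⟩, h'⟩
  case rule_defeater r p b =>
    refine ⟨by simp [IsBase, baseRank], fun hb => ?_⟩
    obtain ⟨b', rfl, h⟩ := hb (.defeater r p b) (List.mem_singleton_self _)
    exact ⟨.defeater r b' p, ⟨h, rfl⟩, rfl, rfl⟩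
  all_goals first
    | exact ha.elim
    | simp [Represents]

/-- Converse of the previous lemma. An atom that holds as intended has a clause which is a fact or
calls one represented atom of smaller rank, so it becomes true after as many steps as its rank
allows. -/
theorem exists_clause_of_represents {a : MetaAtom P Λ} (hR : Represents D a) :
    ∃ b, (b = [] ∨ ∃ a', b = [.pos a'] ∧ Represents D a' ∧ IsBase a' ∧
      baseRank a' < baseRank a) ∧ ⟨a, b⟩ ∈ freeProgram D := by
  have fact : ⟨a, []⟩ ∈ freeProgram D → ∃ b, (b = [] ∨ ∃ a', b = [.pos a'] ∧ Represents D a' ∧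
      IsBase a' ∧ baseRank a' < baseRank a) ∧ ⟨a, b⟩ ∈ freeProgram D :=
    fun h => ⟨[], Or.inl rfl, h⟩
  have unit : ∀ a', ⟨a, [.pos a']⟩ ∈ freeProgram D → Represents D a' → IsBase a' →
      baseRank a' < baseRank a → ∃ b, (b = [] ∨ ∃ a', b = [.pos a'] ∧ Represents D a' ∧
      IsBase a' ∧ baseRank a' < baseRank a) ∧ ⟨a, b⟩ ∈ freeProgram D :=
    fun a' h h1 h2 h3 => ⟨[.pos a'], Or.inr ⟨a', rfl, h1, h2, h3⟩, h⟩
  cases a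
  case fact => exact fact (.fact _ hR)
  case strict => exact fact (.strict _ _ _ ((strict_mem_annotate_free D).2 hR))
  case defeasible => exact fact (.defeasible _ _ _ ((defeasible_mem_annotate_free D).2 hR))
  case defeater => exact fact (.defeater _ _ _ ((defeater_mem_annotate_free D).2 hR))
  case sup =>
    obtain ⟨r, hr, s, hs, rfl, rfl, h⟩ := hR
    have := MetaProgram.sup (D := D.annotate (freeAnnotation Λ)) _ _ ⟨r, hr, rfl⟩ ⟨s, hs, rfl⟩
      (by rw [Rule.label_annotate, Rule.label_annotate]; exact h)
    rw [Rule.label_annotate, Rule.label_annotate] at this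
    exact fact this
  case team =>
    obtain ⟨d, rfl | rfl, rfl⟩ := hR
    exacts [fact .team_partial, fact .team_delta]
  case indiv =>
    obtain ⟨d, rfl | rfl, rfl⟩ := hR
    exacts [fact .indiv_partialStar, fact .indiv_deltaStar]
  case ambiguityBlocking =>
    obtain ⟨d, rfl | rfl, rfl⟩ := hR
    exacts [fact .blocking_partial, fact .blocking_partialStar]
  case ambiguityPropagating =>
    obtain ⟨d, rfl | rfl, rfl⟩ := hR
    exacts [fact .propagating_delta, fact .propagating_deltaStar]
  case proofTag =>
    obtain ⟨d, rfl⟩ := hR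
    exact fact (.proofTag d)
  case supportiveRule =>
    obtain ⟨r, ⟨hr, hs, rfl⟩, rfl, rfl⟩ := hR
    cases r
    · exact unit (.strict _ _ _) (.supportive_strict _ _ _) hr trivial Nat.zero_lt_one
    · exact unit (.defeasible _ _ _) (.supportive_defeasible _ _ _) ⟨_, rfl, hr⟩ trivial
        Nat.zero_lt_one
    · exact hs.elim
  case rule =>
    obtain ⟨r, ⟨hr, rfl⟩, rfl, rfl⟩ := hR
    cases r
    · exact unit (.supportiveRule _ _ _) (.rule_supportive _ _ _) ⟨_, ⟨hr, trivial, rfl⟩, rfl, rfl⟩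
        trivial Nat.one_lt_two
    · exact unit (.supportiveRule _ _ _) (.rule_supportive _ _ _) ⟨_, ⟨hr, trivial, rfl⟩, rfl, rfl⟩
        trivial Nat.one_lt_two
    · exact unit (.defeater _ _ _) (.rule_defeater _ _ _) ⟨_, rfl, hr⟩ trivial Nat.two_pos
  all_goals exact hR.elim

theorem fittingIter_base (a : MetaAtom P Λ) (ha : IsBase a) (n : ℕ) (hn : baseRank a < n) :
    (Represents D a → a ∈ (fittingIter (freeProgram D) n).trueSet) ∧
      (¬ Represents D a → a ∈ (fittingIter (freeProgram D) n).falseSet) := by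
  induction n generalizing a with
  | zero => omega
  | succ n ih =>
    constructor
    · intro hR
      obtain ⟨b, hb, hc⟩ := exists_clause_of_represents hR
      refine ⟨_, hc, rfl, ?_⟩
      rcases hb with rfl | ⟨a', rfl, hR', ha', hlt⟩
      · simp
      · intro L hL
        obtain rfl := List.mem_singleton.1 hL
        exact (ih a' ha' (by omega)).1 hR'
    · rintro hR c hc rfl
      obtain ⟨h1, h2⟩ := base_of_clause hc ha
      -- If the clause were not refuted, every base atom in its body would be represented, by the
      -- induction hypothesis on rank, and so would the head.
      by_contra! hcon
      refine hR (h2 fun b hb => ?_)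
      by_contra hRb
      obtain ⟨_, ⟨⟩, hb', hlt⟩ := h1 _ hb
      exact hcon _ hb ((ih b hb' (by omega)).2 hRb)

/-- For all large `n`, the iterate decides all base atoms as intended. -/
theorem eventually_fittingIter_base : ∀ᶠ n in atTop, ∀ a : MetaAtom P Λ, IsBase a →
    (Represents D a → a ∈ (fittingIter (freeProgram D) n).trueSet) ∧
      (¬ Represents D a → a ∈ (fittingIter (freeProgram D) n).falseSet) := by
  -- The rank is at most 2 (`rule` calls `supportiveRule`, which calls the listed rules), so one
  -- stage serves all of the infinitely many base atoms.
  refine eventually_atTop.2 ⟨3, fun n hn a ha => fittingIter_base a ha n ?_⟩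
  have : baseRank a ≤ 2 := by cases a <;> simp [baseRank]
  omega

theorem KunenEntails.of_represents {a : MetaAtom P Λ} (ha : IsBase a) (h : Represents D a) :
    KunenEntails (freeProgram D) (.pos a) :=
  ⟨baseRank a + 1, (fittingIter_base a ha _ (Nat.lt_succ_self _)).1 h⟩

end Free

/-! ## From the meta-program to proofs -/

section Soundness

variable {P Λ : Type*}

/-- The atoms that hold when `S` is the set of provable conclusions; no demand is made on atoms
for other tags than `d` and `free`. -/
def HoldsIn (D : DefeasibleTheory P Λ) (d : ProofTag) (S : Set (Conclusion P)) :
    MetaAtom P Λ → Prop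
  | .definitely x => .plus .definite x ∈ S
  | .defeasibly Z e => ∀ x, Z = .proof d → e = .lit ⟨.free, x⟩ ∨ e = .lit ⟨.proof d, x⟩ →
      .plus (.main d) x ∈ S
  | .overruled Z l x => Z = .proof d → ∃ s ∈ D.rulesFor x.compl,
      (∀ a ∈ s.antecedent, .plus (attackTag d) a ∈ S) ∧ FailsToDefeat D d S l s.label x
  | .defeated Z l m y => Z = .proof d → Defeats D d S l m y.compl
  | .supported Z e => ∀ x, Z = .proof d → e = .lit ⟨.free, x⟩ ∨ e = .lit ⟨.proof d, x⟩ →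
      d = .delta ∨ d = .deltaStar → .plus (.supp d) x ∈ S
  | .beaten Z l x => Z = .proof d → ∃ s ∈ D.rulesFor x.compl,
      (∀ a ∈ s.antecedent, .plus (.main d) a ∈ S) ∧ D.SupLabels s.label l
  | a => Represents D a

/-- The atoms that fail when `S` is the set of provable conclusions. -/
def FailsIn (D : DefeasibleTheory P Λ) (d : ProofTag) (S : Set (Conclusion P)) :
    MetaAtom P Λ → Prop
  | .definitely x => .minus .definite x ∈ S
  | .defeasibly Z e => ∀ x, Z = .proof d → e = .lit ⟨.free, x⟩ ∨ e = .lit ⟨.proof d, x⟩ →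
      .minus (.main d) x ∈ S
  | .overruled Z l x => Z = .proof d → ∀ s ∈ D.rulesFor x.compl,
      (∃ a ∈ s.antecedent, .minus (attackTag d) a ∈ S) ∨ Defeats D d S l s.label x
  | .defeated Z l m y => Z = .proof d → FailsToDefeat D d S l m y.compl
  | .supported Z e => ∀ x, Z = .proof d → e = .lit ⟨.free, x⟩ ∨ e = .lit ⟨.proof d, x⟩ →
      d = .delta ∨ d = .deltaStar → .minus (.supp d) x ∈ S
  | .beaten Z l x => Z = .proof d → ∀ s ∈ D.rulesFor x.compl,
      (∃ a ∈ s.antecedent, .minus (.main d) a ∈ S) ∨ ¬ D.SupLabels s.label l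
  | a => ¬ Represents D a

/-- The interpretation of the meta-program given by a set of conclusions. -/
def conclusionInterp (D : DefeasibleTheory P Λ) (d : ProofTag) (S : Set (Conclusion P)) :
    PartialInterp (MetaAtom P Λ) :=
  ⟨{a | HoldsIn D d S a}, {a | FailsIn D d S a}⟩

variable {D : DefeasibleTheory P Λ} {d : ProofTag} {S : Set (Conclusion P)}

theorem holdsIn_iff_of_isBase {a : MetaAtom P Λ} (ha : IsBase a) :
    HoldsIn D d S a ↔ Represents D a := by
  cases a <;> first | exact ha.elim | exact Iff.rfl

theorem failsIn_iff_of_isBase {a : MetaAtom P Λ} (ha : IsBase a) :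
    FailsIn D d S a ↔ ¬ Represents D a := by
  cases a <;> first | exact ha.elim | exact Iff.rfl

theorem attackTag_of_blocking (h : d = .partialTag ∨ d = .partialStar) :
    attackTag d = .main d := by
  rcases h with rfl | rfl <;> rfl

theorem attackTag_of_propagating (h : d = .delta ∨ d = .deltaStar) :
    attackTag d = .supp d := by
  rcases h with rfl | rfl <;> rfl

theorem mem_freeBody {l : List (Literal P)} {a : Literal P} (h : a ∈ l) :
    BodyExpr.lit ⟨.free, a⟩ ∈ freeBody l :=
  List.mem_map_of_mem h

/-- Each clause of the meta-program mirrors a piece of an inference rule. Closure of `S` is invoked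
only for `definitely`, `defeasibly` and `supported`; for the auxiliary predicates, `HoldsIn` is by
definition what the clause body says. -/
theorem holdsIn_of_clause (hS : ∀ c, Infers D d S c → c ∈ S) {c : Clause (MetaAtom P Λ)}
    (hc : c ∈ freeProgram D) (hb : ∀ L ∈ c.body, L.IsTrue (conclusionInterp D d S)) :
    HoldsIn D d S c.head := by
  by_cases hbase : IsBase c.head
  · obtain ⟨h1, h2⟩ := base_of_clause hc hbase
    refine (holdsIn_iff_of_isBase hbase).2 (h2 fun b hbc => ?_)
    obtain ⟨_, ⟨⟩, hb', -⟩ := h1 _ hbc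
    exact (holdsIn_iff_of_isBase hb').1 (hb _ hbc)
  have hpos : ∀ a, .pos a ∈ c.body → HoldsIn D d S a := fun a ha => hb _ ha
  have hnot : ∀ a, .not a ∈ c.body → FailsIn D d S a := fun a ha => hb _ ha
  clear hb
  cases hc
  case definitely_fact x =>
    exact hS _ (.plus_definite _ _ _ (Or.inl (hpos (.fact x) (by simp))))
  case definitely_strict r x y =>
    have h : Rule.strict r y x ∈ D.rules := hpos (.strict r x y) (by simp)
    exact hS _ (.plus_definite _ _ _ (Or.inr ⟨_, ⟨h, trivial, rfl⟩, fun a ha =>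
      hpos (.definitely a) (List.mem_cons_of_mem _ (List.mem_map_of_mem ha))⟩))
  case defeasibly_free Z x =>
    rintro y rfl (h | h)
    · cases h
      exact hpos (.defeasibly _ _) (by simp) _ rfl (Or.inr rfl)
    · cases h
  case defeasibly_fail => rintro y - (h | h) <;> cases h
  case defeasibly_definitely Z Y x =>
    have h : .plus .definite x ∈ S := hpos (.definitely x) (by simp)
    have h' := hS _ ((infers_plus_main_iff D d S x).2 (Or.inl h))
    rintro y rfl (h | h) <;> cases h <;> exact h'
  case defeasibly_rule Z Y x l w =>
    rintro y rfl (h | h)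
    · cases h
      -- The rule clause never applies with the tag `free`, which is not a proof tag; a `free`
      -- literal is reached only through the `free` or `definitely` clauses.
      obtain ⟨d', hd'⟩ := hpos (.proofTag .free) (by simp)
      cases hd'
    · cases h
      obtain ⟨r, hr, rfl, rfl⟩ := hpos (.supportiveRule l x w) (by simp)
      refine hS _ ((infers_plus_main_iff D d S x).2 (Or.inr ⟨r, hr, fun a ha => ?_, ?_, ?_⟩))
      · exact hpos (.defeasibly _ _) (by simpa using mem_freeBody ha) _ rfl (Or.inl rfl)
      · exact hnot (.definitely _) (by simp)
      · exact hnot (.overruled _ _ _) (by simp) rfl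
  case overruled_blocking Z l m x u =>
    rintro rfl
    obtain ⟨d', hd', h⟩ := hpos (.ambiguityBlocking (.proof d)) (by simp)
    cases h
    obtain ⟨s, hs, rfl, rfl⟩ := hpos (.rule m x.compl u) (by simp)
    refine ⟨s, hs, fun a ha => ?_, ?_⟩
    · rw [attackTag_of_blocking hd']
      exact hpos (.defeasibly _ _) (by simpa using mem_freeBody ha) _ rfl (Or.inl rfl)
    · have := hnot (.defeated (.proof d) l s.label x.compl) (by simp) rfl
      -- The last argument of `defeated` is the head of the attacker, so `HoldsIn` and `FailsIn`
      -- complement it to recover the head `x` of the attacked rule.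
      rwa [Literal.compl_compl] at this
  case overruled_propagating Z l m x u =>
    rintro rfl
    obtain ⟨d', hd', h⟩ := hpos (.ambiguityPropagating (.proof d)) (by simp)
    cases h
    obtain ⟨s, hs, rfl, rfl⟩ := hpos (.rule m x.compl u) (by simp)
    refine ⟨s, hs, fun a ha => ?_, ?_⟩
    · rw [attackTag_of_propagating hd']
      exact hpos (.supported _ _) (by simpa using mem_freeBody ha) _ rfl (Or.inl rfl) hd'
    · have := hnot (.defeated (.proof d) l s.label x.compl) (by simp) rfl
      rwa [Literal.compl_compl] at this
  case defeated_team Z l m t x v =>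
    rintro rfl
    obtain ⟨d', hd', h⟩ := hpos (.team (.proof d)) (by simp)
    cases h
    obtain ⟨r, hr, rfl, rfl⟩ := hpos (.supportiveRule t x v) (by simp)
    rw [Literal.compl_compl]
    exact Or.inl ⟨hd', r, hr, fun a ha =>
      hpos (.defeasibly _ _) (by simpa using mem_freeBody ha) _ rfl (Or.inl rfl),
      hpos (.sup _ _) (by simp)⟩
  case defeated_indiv Z l m x =>
    rintro rfl
    obtain ⟨d', hd', h⟩ := hpos (.indiv (.proof d)) (by simp)
    cases h
    exact Or.inr ⟨hd', hpos (.sup _ _) (by simp)⟩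
  case supported_free Z x =>
    rintro y rfl (h | h)
    · cases h
      exact hpos (.supported _ _) (by simp) _ rfl (Or.inr rfl)
    · cases h
  case supported_fail => rintro y - (h | h) <;> cases h
  case supported_definitely Z Y x =>
    have h : .plus .definite x ∈ S := hpos (.definitely x) (by simp)
    rintro y rfl h hd
    have h' := hS _ ((infers_plus_supp_iff D d S x hd).2 (Or.inl ‹_›))
    rcases h with h | h <;> cases h <;> exact h'
  case supported_rule Z Y x l w =>
    rintro y rfl (h | h) hd
    · cases h
      obtain ⟨d', hd'⟩ := hpos (.proofTag .free) (by simp)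
      cases hd'
    · cases h
      obtain ⟨r, hr, rfl, rfl⟩ := hpos (.supportiveRule l x w) (by simp)
      refine hS _ ((infers_plus_supp_iff D d S x hd).2 (Or.inr ⟨r, hr, fun a ha => ?_, ?_⟩))
      · exact hpos (.supported _ _) (by simpa using mem_freeBody ha) _ rfl (Or.inl rfl) hd
      · exact hnot (.beaten _ _ _) (by simp) rfl
  case beaten Z l m x w =>
    rintro rfl
    obtain ⟨s, hs, rfl, rfl⟩ := hpos (.rule m x.compl w) (by simp)
    exact ⟨s, hs, fun a ha =>
      hpos (.defeasibly _ _) (by simpa using mem_freeBody ha) _ rfl (Or.inl rfl),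
      hpos (.sup _ _) (by simp)⟩
  all_goals exact absurd trivial hbase

/-- The hypothesis speaks of all clauses, but only the instances for actual rules of the theory are
needed. In these the descriptive atoms are represented, so the refuted literal must be one of the
informative ones, and it is a premise of the negative inference rule. -/
theorem failsIn_of_clauses (hS : ∀ c, Infers D d S c → c ∈ S) {a : MetaAtom P Λ}
    (h : ∀ b, ⟨a, b⟩ ∈ freeProgram D → (∃ a', .pos a' ∈ b ∧ FailsIn D d S a') ∨
      ∃ a', .not a' ∈ b ∧ HoldsIn D d S a') : FailsIn D d S a := by
  by_cases hbase : IsBase a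
  · refine (failsIn_iff_of_isBase hbase).2 fun hR => ?_
    obtain ⟨b, hb, hc⟩ := exists_clause_of_represents hR
    rcases hb with rfl | ⟨a', rfl, hR', ha', -⟩
    · simpa using h _ hc
    · have := h _ hc
      simp only [List.mem_singleton, ProgLit.pos.injEq, exists_eq_left, reduceCtorEq, false_and,
        exists_false, or_false, failsIn_iff_of_isBase ha'] at this
      exact this hR'
  cases a
  case definitely x =>
    refine hS _ (.minus_definite _ _ _ ⟨?_, ?_⟩)
    · simpa [FailsIn, Represents] using h _ (.definitely_fact x)
    · rintro r ⟨hr, hrs, rfl⟩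
      cases r with
      | strict l b p =>
        have := h _ (.definitely_strict l p b)
        simpa [FailsIn, Represents, hr, Rule.antecedent] using this
      | _ => exact hrs.elim
  case defeasibly Z e =>
    -- The tag `d` carries the content. For `free`, refuting the clause that passes to the subscript
    -- already gives the claim.
    have main : Z = .proof d → ∀ x, e = .lit ⟨.proof d, x⟩ → .minus (.main d) x ∈ S := by
      rintro rfl x rfl
      refine hS _ ((infers_minus_main_iff D d S x).2 ⟨?_, fun r hr => ?_⟩)
      · simpa [FailsIn, Represents] using h _ (.defeasibly_definitely (.proof d) (.proof d) x)
      · have hR : Represents D (.supportiveRule r.label x (freeBody r.antecedent)) :=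
          ⟨r, hr, rfl, rfl⟩
        rcases h _ (.defeasibly_rule (.proof d) (.proof d) x r.label (freeBody r.antecedent)) with
          ⟨a, ha, hf⟩ | ⟨a, ha, hf⟩
        · simp only [List.mem_append, List.mem_cons, List.mem_map, List.not_mem_nil, or_false,
            reduceCtorEq, false_or, ProgLit.pos.injEq] at ha
          rcases ha with (rfl | rfl | rfl) | ⟨e, he, rfl⟩
          · exact absurd ⟨d, rfl⟩ hf
          · exact absurd ⟨d, rfl⟩ hf
          · exact absurd hR hf
          · obtain ⟨y, hy, rfl⟩ := List.mem_map.1 he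
            exact Or.inl ⟨y, hy, hf y rfl (Or.inl rfl)⟩
        · simp only [List.mem_append, List.mem_cons, List.mem_map, List.not_mem_nil, or_false,
            reduceCtorEq, false_or, ProgLit.not.injEq, and_false, exists_false] at ha
          rcases ha with rfl | rfl
          · exact Or.inr (Or.inl hf)
          · exact Or.inr (Or.inr (hf rfl))
    rintro x rfl (rfl | rfl)
    · have := h _ (.defeasibly_free (.proof d) x)
      simp only [List.mem_cons, List.not_mem_nil, or_false, ProgLit.pos.injEq, reduceCtorEq,
        false_and, exists_false, or_self] at this
      obtain ⟨a, rfl | rfl, hf⟩ := this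
      · exact absurd ⟨d, rfl⟩ hf
      · exact hf x rfl (Or.inr rfl)
    · exact main rfl x rfl
  case supported Z e =>
    have main : Z = .proof d → ∀ x, e = .lit ⟨.proof d, x⟩ → d = .delta ∨ d = .deltaStar →
        .minus (.supp d) x ∈ S := by
      rintro rfl x rfl hd
      refine hS _ ((infers_minus_supp_iff D d S x hd).2 ⟨?_, fun r hr => ?_⟩)
      · simpa [FailsIn, Represents] using h _ (.supported_definitely (.proof d) (.proof d) x)
      · have hR : Represents D (.supportiveRule r.label x (freeBody r.antecedent)) :=
          ⟨r, hr, rfl, rfl⟩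
        rcases h _ (.supported_rule (.proof d) (.proof d) x r.label (freeBody r.antecedent)) with
          ⟨a, ha, hf⟩ | ⟨a, ha, hf⟩
        · simp only [List.mem_append, List.mem_cons, List.mem_map, List.not_mem_nil, or_false,
            reduceCtorEq, ProgLit.pos.injEq] at ha
          rcases ha with (rfl | rfl | rfl) | ⟨e, he, rfl⟩
          · exact absurd ⟨d, rfl⟩ hf
          · exact absurd ⟨d, rfl⟩ hf
          · exact absurd hR hf
          · obtain ⟨y, hy, rfl⟩ := List.mem_map.1 he
            exact Or.inl ⟨y, hy, hf y rfl (Or.inl rfl) hd⟩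
        · simp only [List.mem_append, List.mem_cons, List.mem_map, List.not_mem_nil, or_false,
            reduceCtorEq, false_or, ProgLit.not.injEq, and_false, exists_false] at ha
          subst ha
          exact Or.inr (hf rfl)
    rintro x rfl (rfl | rfl)
    · have := h _ (.supported_free (.proof d) x)
      simp only [List.mem_cons, List.not_mem_nil, or_false, ProgLit.pos.injEq, reduceCtorEq,
        false_and, exists_false, or_self] at this
      obtain ⟨a, rfl | rfl, hf⟩ := this
      · exact absurd ⟨d, rfl⟩ hf
      · exact hf x rfl (Or.inr rfl)
    · exact main rfl x rfl
  case overruled Z l x =>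
    rintro rfl s hs
    have hR : Represents D (.rule s.label x.compl (freeBody s.antecedent)) := ⟨s, hs, rfl, rfl⟩
    by_cases hd : d = .delta ∨ d = .deltaStar
    · rw [attackTag_of_propagating hd]
      rcases h _ (.overruled_propagating (.proof d) l s.label x (freeBody s.antecedent)) with
        ⟨a, ha, hf⟩ | ⟨a, ha, hf⟩
      · simp only [List.mem_append, List.mem_cons, List.mem_map, List.not_mem_nil, or_false,
          reduceCtorEq, ProgLit.pos.injEq] at ha
        rcases ha with (rfl | rfl | rfl) | ⟨e, he, rfl⟩
        · exact absurd ⟨d, rfl⟩ hf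
        · exact absurd ⟨d, hd, rfl⟩ hf
        · exact absurd hR hf
        · obtain ⟨y, hy, rfl⟩ := List.mem_map.1 he
          exact Or.inl ⟨y, hy, hf y rfl (Or.inl rfl) hd⟩
      · simp only [List.mem_append, List.mem_cons, List.mem_map, List.not_mem_nil, or_false,
          reduceCtorEq, false_or, ProgLit.not.injEq, and_false, exists_false] at ha
        subst ha
        have := hf rfl
        rw [Literal.compl_compl] at this
        exact Or.inr this
    · have hd : d = .partialTag ∨ d = .partialStar := by cases d <;> simp_all
      rw [attackTag_of_blocking hd]
      rcases h _ (.overruled_blocking (.proof d) l s.label x (freeBody s.antecedent)) with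
        ⟨a, ha, hf⟩ | ⟨a, ha, hf⟩
      · simp only [List.mem_append, List.mem_cons, List.mem_map, List.not_mem_nil, or_false,
          reduceCtorEq, ProgLit.pos.injEq] at ha
        rcases ha with (rfl | rfl | rfl) | ⟨e, he, rfl⟩
        · exact absurd ⟨d, rfl⟩ hf
        · exact absurd ⟨d, hd, rfl⟩ hf
        · exact absurd hR hf
        · obtain ⟨y, hy, rfl⟩ := List.mem_map.1 he
          exact Or.inl ⟨y, hy, hf y rfl (Or.inl rfl)⟩
      · simp only [List.mem_append, List.mem_cons, List.mem_map, List.not_mem_nil, or_false,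
          reduceCtorEq, false_or, ProgLit.not.injEq, and_false, exists_false] at ha
        subst ha
        have := hf rfl
        rw [Literal.compl_compl] at this
        exact Or.inr this
  case defeated Z l m y =>
    rintro rfl
    -- The clauses for `defeated` have a complement in the head; every literal has that form.
    obtain ⟨x, rfl⟩ : ∃ x : Literal P, y = x.compl := ⟨y.compl, (Literal.compl_compl y).symm⟩
    rw [Literal.compl_compl]
    refine ⟨fun hd r hr => ?_, fun hd => ?_⟩
    · have hR : Represents D (.supportiveRule r.label x (freeBody r.antecedent)) :=
        ⟨r, hr, rfl, rfl⟩
      rcases h _ (.defeated_team (.proof d) l m r.label x (freeBody r.antecedent)) with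
        ⟨a, ha, hf⟩ | ⟨a, ha, hf⟩
      · simp only [List.mem_append, List.mem_cons, List.mem_map, List.not_mem_nil, or_false,
          ProgLit.pos.injEq] at ha
        rcases ha with (rfl | rfl | rfl | rfl) | ⟨e, he, rfl⟩
        · exact absurd ⟨d, rfl⟩ hf
        · exact absurd ⟨d, hd, rfl⟩ hf
        · exact Or.inr hf
        · exact absurd hR hf
        · obtain ⟨y, hy, rfl⟩ := List.mem_map.1 he
          exact Or.inl ⟨y, hy, hf y rfl (Or.inl rfl)⟩
      · simp at ha
    · rcases h _ (.defeated_indiv (.proof d) l m x) with ⟨a, ha, hf⟩ | ⟨a, ha, hf⟩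
      · simp only [List.mem_cons, List.not_mem_nil, or_false, ProgLit.pos.injEq] at ha
        rcases ha with rfl | rfl | rfl
        · exact absurd ⟨d, rfl⟩ hf
        · exact absurd ⟨d, hd, rfl⟩ hf
        · exact hf
      · simp at ha
  case beaten Z l x =>
    rintro rfl s hs
    have hR : Represents D (.rule s.label x.compl (freeBody s.antecedent)) := ⟨s, hs, rfl, rfl⟩
    rcases h _ (.beaten (.proof d) l s.label x (freeBody s.antecedent)) with
      ⟨a, ha, hf⟩ | ⟨a, ha, hf⟩
    · simp only [List.mem_append, List.mem_cons, List.mem_map, List.not_mem_nil, or_false,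
        ProgLit.pos.injEq] at ha
      rcases ha with ((rfl | rfl) | ⟨e, he, rfl⟩) | rfl
      · exact absurd ⟨d, rfl⟩ hf
      · exact absurd hR hf
      · obtain ⟨y, hy, rfl⟩ := List.mem_map.1 he
        exact Or.inl ⟨y, hy, hf y rfl (Or.inl rfl)⟩
      · exact Or.inr hf
    · simp at ha
  all_goals exact absurd trivial hbase

theorem kunenEntails_sound (hS : ∀ c, Infers D d S c → c ∈ S) {L : ProgLit (MetaAtom P Λ)}
    (h : KunenEntails (freeProgram D) L) : L.IsTrue (conclusionInterp D d S) := by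
  obtain ⟨n, hn⟩ := h
  have key := fittingIter_subset_of_prefixed (Pr := freeProgram D) (J := conclusionInterp D d S)
    (by
      rintro a ⟨c, hc, rfl, hb⟩
      exact holdsIn_of_clause hS hc hb)
    (by
      intro a ha
      refine failsIn_of_clauses hS fun b hb => ?_
      obtain ⟨L | L, hL, hf⟩ := ha _ hb rfl
      exacts [Or.inl ⟨_, hL, hf⟩, Or.inr ⟨_, hL, hf⟩]) n
  cases L with
  | pos a => exact key.1 hn
  | not a => exact key.2 hn

end Soundness

/-! ## From proofs to the meta-program -/

section Completeness

variable {P Λ : Type*}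

/-- The conclusions whose counterparts are consequences of the meta-program. -/
def Realized (D : DefeasibleTheory P Λ) (d : ProofTag) : Set (Conclusion P) :=
  {c | match c with
    | .plus .definite x => KunenEntails (freeProgram D) (.pos (.definitely x))
    | .minus .definite x => KunenEntails (freeProgram D) (.not (.definitely x))
    | .plus (.main d') x => d' = d → ∀ t, t = .free ∨ t = .proof d →
        KunenEntails (freeProgram D) (.pos (.defeasibly (.proof d) (.lit ⟨t, x⟩)))
    | .minus (.main d') x => d' = d → ∀ t, t = .free ∨ t = .proof d →
        KunenEntails (freeProgram D) (.not (.defeasibly (.proof d) (.lit ⟨t, x⟩)))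
    | .plus (.supp d') x => d' = d → ∀ t, t = .free ∨ t = .proof d →
        KunenEntails (freeProgram D) (.pos (.supported (.proof d) (.lit ⟨t, x⟩)))
    | .minus (.supp d') x => d' = d → ∀ t, t = .free ∨ t = .proof d →
        KunenEntails (freeProgram D) (.not (.supported (.proof d) (.lit ⟨t, x⟩)))}

variable {D : DefeasibleTheory P Λ} {d : ProofTag}

theorem pos_mem_map_freeBody {f : BodyExpr P → MetaAtom P Λ} {l : List (Literal P)} {a : Literal P}
    (h : a ∈ l) : ProgLit.pos (f (.lit ⟨.free, a⟩)) ∈ (freeBody l).map fun e => .pos (f e) :=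
  List.mem_map_of_mem (f := fun e => ProgLit.pos (f e)) (mem_freeBody h)

theorem kunenEntails_map_freeBody {f : BodyExpr P → MetaAtom P Λ} {l : List (Literal P)}
    (h : ∀ a ∈ l, KunenEntails (freeProgram D) (.pos (f (.lit ⟨.free, a⟩))))
    {L : ProgLit (MetaAtom P Λ)} (hL : L ∈ (freeBody l).map fun e => ProgLit.pos (f e)) :
    KunenEntails (freeProgram D) L := by
  simp only [freeBody, List.map_map, List.mem_map] at hL
  obtain ⟨a, ha, rfl⟩ := hL
  exact h a ha

theorem KunenEntails.of_metaProgram {a : MetaAtom P Λ} {b : List (ProgLit (MetaAtom P Λ))}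
    (hc : MetaProgram (D.annotate (freeAnnotation Λ)) ⟨a, b⟩)
    (h : ∀ L ∈ b, KunenEntails (freeProgram D) L) : KunenEntails (freeProgram D) (.pos a) :=
  .of_clause (c := ⟨a, b⟩) hc h

theorem kunenEntails_proofTag : KunenEntails (freeProgram D) (.pos (.proofTag (.proof d))) :=
  .of_represents trivial ⟨d, rfl⟩

theorem not_represents_proofTag_free : ¬ Represents D (.proofTag .free) := by
  rintro ⟨d, hd⟩
  cases hd

theorem eventually_isFalse_of_exists {l : List (Literal P)} {f : BodyExpr P → MetaAtom P Λ}
    (h : ∃ a ∈ l, KunenEntails (freeProgram D) (.not (f (.lit ⟨.free, a⟩)))) :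
    ∀ᶠ n in atTop, ∃ L ∈ (freeBody l).map (fun e => ProgLit.pos (f e)),
      L.IsFalse (fittingIter (freeProgram D) n) := by
  obtain ⟨a, ha, h⟩ := h
  exact h.eventually.mono fun n hn => ⟨_, pos_mem_map_freeBody ha, hn⟩

/-- If every clause with a given head is false in almost all iterates, provided that it satisfies
the intended meaning of base atoms, then the head is false. -/
theorem KunenEntails.not_of_base {a : MetaAtom P Λ}
    (h : ∀ᶠ n in atTop, ∀ b, ⟨a, b⟩ ∈ freeProgram D →
      (∀ a', .pos a' ∈ b → IsBase a' → Represents D a') →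
        ∃ L ∈ b, L.IsFalse (fittingIter (freeProgram D) n)) :
    KunenEntails (freeProgram D) (.not a) := by
  refine .not_of_eventually ?_
  filter_upwards [h, eventually_fittingIter_base (D := D)] with n hn hbase
  rintro ⟨a, b⟩ hc rfl
  by_cases hb : ∀ a', .pos a' ∈ b → IsBase a' → Represents D a'
  · exact hn b hc hb
  · push Not at hb
    obtain ⟨a', ha', h1, h2⟩ := hb
    exact ⟨_, ha', (hbase a' h1).2 h2⟩

theorem realized_plus_definite {x : Literal P}
    (h : Infers D d (Realized D d) (.plus .definite x)) :
    KunenEntails (freeProgram D) (.pos (.definitely x)) := by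
  rcases (infers_plus_definite_iff _ _ _ _).1 h with h | ⟨r, ⟨hr, hrs, rfl⟩, hra⟩
  · refine .of_metaProgram (.definitely_fact x) ?_
    simp only [List.mem_singleton, forall_eq]
    exact .of_represents trivial h
  · cases r with
    | strict l b p =>
      refine .of_metaProgram (.definitely_strict l p b) ?_
      simp only [List.mem_cons, List.mem_map, forall_eq_or_imp, forall_exists_index, and_imp,
        forall_apply_eq_imp_iff₂]
      exact ⟨.of_represents trivial hr, hra⟩
    | _ => exact hrs.elim

/-- Pattern of all the negative cases: each of the finitely many relevant rules is refuted from some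
stage on, hence all are from a common stage, and `not_of_base` disposes of the instances that do not
belong to the theory. -/
theorem realized_minus_definite {x : Literal P}
    (h : Infers D d (Realized D d) (.minus .definite x)) :
    KunenEntails (freeProgram D) (.not (.definitely x)) := by
  obtain ⟨h1, h2⟩ := (infers_minus_definite_iff _ _ _ _).1 h
  have : ∀ᶠ n in atTop, ∀ r ∈ D.strictRules x, ∃ a ∈ r.antecedent,
      .definitely a ∈ (fittingIter (freeProgram D) n).falseSet := by
    refine (eventually_all_finite (D.finite_strictRules x)).2 fun r hr => ?_
    obtain ⟨a, ha, h⟩ := h2 r hr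
    exact (KunenEntails.eventually h).mono fun n hn => ⟨a, ha, hn⟩
  refine .not_of_base ?_
  filter_upwards [this] with n hn
  intro b hc hb
  cases hc with
  | definitely_fact => exact absurd (hb (.fact x) (by simp) trivial) h1
  | definitely_strict r _ y =>
    obtain ⟨a, ha, hf⟩ := hn _ ⟨hb (.strict r x y) (by simp) trivial, trivial, rfl⟩
    exact ⟨_, List.mem_cons_of_mem _ (List.mem_map_of_mem ha), hf⟩

/-! ### Realizing the auxiliary predicates: defeat, overruling, beating. -/

theorem realized_defeated {l m : Λ} {x : Literal P} (h : Defeats D d (Realized D d) l m x) :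
    KunenEntails (freeProgram D) (.pos (.defeated (.proof d) l m x.compl)) := by
  rcases h with ⟨hd, t, ht, hta, hs⟩ | ⟨hd, hs⟩
  · refine .of_metaProgram (.defeated_team (.proof d) l m t.label x (freeBody t.antecedent)) ?_
    intro L hL
    rcases List.mem_append.1 hL with hL | hL
    · simp only [List.mem_cons, List.not_mem_nil, or_false] at hL
      rcases hL with rfl | rfl | rfl | rfl
      · exact kunenEntails_proofTag
      · exact .of_represents trivial ⟨d, hd, rfl⟩
      · exact .of_represents trivial hs
      · exact .of_represents trivial ⟨t, ht, rfl, rfl⟩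
    · exact kunenEntails_map_freeBody (fun a ha => hta a ha rfl _ (Or.inl rfl)) hL
  · refine .of_metaProgram (.defeated_indiv (.proof d) l m x) ?_
    intro L hL
    simp only [List.mem_cons, List.not_mem_nil, or_false] at hL
    rcases hL with rfl | rfl | rfl
    · exact kunenEntails_proofTag
    · exact .of_represents trivial ⟨d, hd, rfl⟩
    · exact .of_represents trivial hs

theorem realized_not_defeated {l m : Λ} {y : Literal P}
    (h : FailsToDefeat D d (Realized D d) l m y.compl) :
    KunenEntails (freeProgram D) (.not (.defeated (.proof d) l m y)) := by
  have : ∀ᶠ n in atTop, ∀ t ∈ D.supportiveRules y.compl,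
      (d = .partialTag ∨ d = .delta) → D.SupLabels t.label m →
      ∃ L ∈ (freeBody t.antecedent).map (fun e => ProgLit.pos (.defeasibly (.proof d) e)),
        L.IsFalse (fittingIter (freeProgram D) n) := by
    refine (eventually_all_finite (D.finite_supportiveRules _)).2 fun t ht => ?_
    by_cases hd : (d = .partialTag ∨ d = .delta) ∧ D.SupLabels t.label m
    · obtain ⟨a, ha, h⟩ := (h.1 hd.1 t ht).resolve_right (not_not.2 hd.2)
      exact (eventually_isFalse_of_exists ⟨a, ha, h rfl _ (Or.inl rfl)⟩).mono fun n hn _ _ => hn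
    · exact Eventually.of_forall fun n h1 h2 => absurd ⟨h1, h2⟩ hd
  refine .not_of_base ?_
  filter_upwards [this] with n hn
  intro b hc hb
  cases hc with
  | defeated_team _ _ _ t x v =>
    obtain ⟨d', hd', h'⟩ := hb (.team (.proof d)) (by simp) trivial
    cases h'
    obtain ⟨r, hr, rfl, rfl⟩ := hb (.supportiveRule t x v) (by simp) trivial
    rw [Literal.compl_compl] at hn
    obtain ⟨L, hL, hf⟩ := hn r hr hd' (hb (.sup r.label m) (by simp) trivial)
    exact ⟨L, List.mem_append_right _ hL, hf⟩
  | defeated_indiv _ _ _ x =>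
    obtain ⟨d', hd', h'⟩ := hb (.indiv (.proof d)) (by simp) trivial
    cases h'
    exact absurd (hb (.sup l m) (by simp) trivial) (h.2 hd')

theorem realized_overruled {l : Λ} {x : Literal P} {s : Rule P Λ (Literal P)}
    (hs : s ∈ D.rulesFor x.compl) (h : ∀ a ∈ s.antecedent, .plus (attackTag d) a ∈ Realized D d)
    (hf : FailsToDefeat D d (Realized D d) l s.label x) :
    KunenEntails (freeProgram D) (.pos (.overruled (.proof d) l x)) := by
  have hnd : KunenEntails (freeProgram D) (.not (.defeated (.proof d) l s.label x.compl)) :=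
    realized_not_defeated (by rwa [Literal.compl_compl])
  by_cases hd : d = .delta ∨ d = .deltaStar
  · rw [attackTag_of_propagating hd] at h
    refine .of_metaProgram (.overruled_propagating (.proof d) l s.label x (freeBody s.antecedent)) ?_
    intro L hL
    rcases List.mem_append.1 hL with hL | hL
    · rcases List.mem_append.1 hL with hL | hL
      · simp only [List.mem_cons, List.not_mem_nil, or_false] at hL
        rcases hL with rfl | rfl | rfl
        · exact kunenEntails_proofTag
        · exact .of_represents trivial ⟨d, hd, rfl⟩
        · exact .of_represents trivial ⟨s, hs, rfl, rfl⟩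
      · exact kunenEntails_map_freeBody (fun a ha => h a ha rfl _ (Or.inl rfl)) hL
    · obtain rfl := List.mem_singleton.1 hL
      exact hnd
  · have hd : d = .partialTag ∨ d = .partialStar := by cases d <;> simp_all
    rw [attackTag_of_blocking hd] at h
    refine .of_metaProgram (.overruled_blocking (.proof d) l s.label x (freeBody s.antecedent)) ?_
    intro L hL
    rcases List.mem_append.1 hL with hL | hL
    · rcases List.mem_append.1 hL with hL | hL
      · simp only [List.mem_cons, List.not_mem_nil, or_false] at hL
        rcases hL with rfl | rfl | rfl
        · exact kunenEntails_proofTag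
        · exact .of_represents trivial ⟨d, hd, rfl⟩
        · exact .of_represents trivial ⟨s, hs, rfl, rfl⟩
      · exact kunenEntails_map_freeBody (fun a ha => h a ha rfl _ (Or.inl rfl)) hL
    · obtain rfl := List.mem_singleton.1 hL
      exact hnd

theorem realized_not_overruled {l : Λ} {x : Literal P}
    (h : ∀ s ∈ D.rulesFor x.compl, (∃ a ∈ s.antecedent, .minus (attackTag d) a ∈ Realized D d) ∨
      Defeats D d (Realized D d) l s.label x) :
    KunenEntails (freeProgram D) (.not (.overruled (.proof d) l x)) := by
  -- Both clauses for `overruled` are prepared at once: the false body literal is an atom of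
  -- `supported` or of `defeasibly` according to the class of `d`, and the classification atoms
  -- later select the right one.
  have : ∀ᶠ n in atTop, ∀ s ∈ D.rulesFor x.compl,
      (∃ a ∈ s.antecedent,
        ((d = .delta ∨ d = .deltaStar) → .supported (.proof d) (.lit ⟨.free, a⟩) ∈
          (fittingIter (freeProgram D) n).falseSet) ∧
        ((d = .partialTag ∨ d = .partialStar) → .defeasibly (.proof d) (.lit ⟨.free, a⟩) ∈
          (fittingIter (freeProgram D) n).falseSet)) ∨
      .defeated (.proof d) l s.label x.compl ∈ (fittingIter (freeProgram D) n).trueSet := by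
    refine (eventually_all_finite (D.finite_rulesFor _)).2 fun s hs => ?_
    rcases h s hs with ⟨a, ha, h⟩ | h
    · by_cases hd : d = .delta ∨ d = .deltaStar
      · rw [attackTag_of_propagating hd] at h
        refine (h rfl _ (Or.inl rfl)).eventually.mono fun n hn => Or.inl ⟨a, ha, fun _ => hn, ?_⟩
        rcases hd with rfl | rfl <;> simp
      · have hd' : d = .partialTag ∨ d = .partialStar := by cases d <;> simp_all
        rw [attackTag_of_blocking hd'] at h
        exact (h rfl _ (Or.inl rfl)).eventually.mono fun n hn =>
          Or.inl ⟨a, ha, fun h => absurd h hd, fun _ => hn⟩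
    · exact (realized_defeated h).eventually.mono fun n hn => Or.inr hn
  refine .not_of_base ?_
  filter_upwards [this] with n hn
  intro b hc hb
  cases hc with
  | overruled_blocking _ _ m _ u =>
    obtain ⟨d', hd', h'⟩ := hb (.ambiguityBlocking (.proof d)) (by simp) trivial
    cases h'
    obtain ⟨s, hs, rfl, rfl⟩ := hb (.rule m x.compl u) (by simp) trivial
    rcases hn s hs with ⟨a, ha, -, h⟩ | h
    · exact ⟨_, List.mem_append_left _ (List.mem_append_right _ (pos_mem_map_freeBody ha)), h hd'⟩
    · exact ⟨_, List.mem_append_right _ (List.mem_singleton_self _), h⟩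
  | overruled_propagating _ _ m _ u =>
    obtain ⟨d', hd', h'⟩ := hb (.ambiguityPropagating (.proof d)) (by simp) trivial
    cases h'
    obtain ⟨s, hs, rfl, rfl⟩ := hb (.rule m x.compl u) (by simp) trivial
    rcases hn s hs with ⟨a, ha, h, -⟩ | h
    · exact ⟨_, List.mem_append_left _ (List.mem_append_right _ (pos_mem_map_freeBody ha)), h hd'⟩
    · exact ⟨_, List.mem_append_right _ (List.mem_singleton_self _), h⟩

theorem realized_beaten {l : Λ} {x : Literal P} {s : Rule P Λ (Literal P)}
    (hs : s ∈ D.rulesFor x.compl) (h : ∀ a ∈ s.antecedent, .plus (.main d) a ∈ Realized D d)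
    (hsup : D.SupLabels s.label l) :
    KunenEntails (freeProgram D) (.pos (.beaten (.proof d) l x)) := by
  refine .of_metaProgram (.beaten (.proof d) l s.label x (freeBody s.antecedent)) ?_
  intro L hL
  rcases List.mem_append.1 hL with hL | hL
  · rcases List.mem_append.1 hL with hL | hL
    · simp only [List.mem_cons, List.not_mem_nil, or_false] at hL
      rcases hL with rfl | rfl
      · exact kunenEntails_proofTag
      · exact .of_represents trivial ⟨s, hs, rfl, rfl⟩
    · exact kunenEntails_map_freeBody (fun a ha => h a ha rfl _ (Or.inl rfl)) hL
  · obtain rfl := List.mem_singleton.1 hL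
    exact .of_represents trivial hsup

theorem realized_not_beaten {l : Λ} {x : Literal P}
    (h : ∀ s ∈ D.rulesFor x.compl, (∃ a ∈ s.antecedent, .minus (.main d) a ∈ Realized D d) ∨
      ¬ D.SupLabels s.label l) :
    KunenEntails (freeProgram D) (.not (.beaten (.proof d) l x)) := by
  have : ∀ᶠ n in atTop, ∀ s ∈ D.rulesFor x.compl, D.SupLabels s.label l →
      ∃ L ∈ (freeBody s.antecedent).map (fun e => ProgLit.pos (.defeasibly (.proof d) e)),
        L.IsFalse (fittingIter (freeProgram D) n) := by
    refine (eventually_all_finite (D.finite_rulesFor _)).2 fun s hs => ?_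
    rcases h s hs with ⟨a, ha, h⟩ | h
    · exact (eventually_isFalse_of_exists ⟨a, ha, h rfl _ (Or.inl rfl)⟩).mono fun n hn _ => hn
    · exact Eventually.of_forall fun n h' => absurd h' h
  refine .not_of_base ?_
  filter_upwards [this] with n hn
  intro b hc hb
  cases hc with
  | beaten _ _ m _ w =>
    obtain ⟨s, hs, rfl, rfl⟩ := hb (.rule m x.compl w) (by simp) trivial
    obtain ⟨L, hL, hf⟩ := hn s hs (hb (.sup s.label l) (by simp) trivial)
    exact ⟨L, List.mem_append_left _ (List.mem_append_right _ hL), hf⟩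

/-! ### Realizing defeasible provability and support. -/

theorem realized_plus_main {x : Literal P}
    (h : Infers D d (Realized D d) (.plus (.main d) x)) (t : Tag) (ht : t = .free ∨ t = .proof d) :
    KunenEntails (freeProgram D) (.pos (.defeasibly (.proof d) (.lit ⟨t, x⟩))) := by
  have main : KunenEntails (freeProgram D)
      (.pos (.defeasibly (.proof d) (.lit ⟨.proof d, x⟩))) := by
    rcases (infers_plus_main_iff _ _ _ _).1 h with h | ⟨r, hr, hra, hx, hs⟩
    · refine .of_metaProgram (.defeasibly_definitely (.proof d) (.proof d) x) ?_
      simp only [List.mem_cons, List.not_mem_nil, or_false, forall_eq_or_imp, forall_eq]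
      exact ⟨kunenEntails_proofTag, h⟩
    · refine .of_metaProgram
        (.defeasibly_rule (.proof d) (.proof d) x r.label (freeBody r.antecedent)) ?_
      intro L hL
      rcases List.mem_append.1 hL with hL | hL
      · rcases List.mem_append.1 hL with hL | hL
        · simp only [List.mem_cons, List.not_mem_nil, or_false] at hL
          rcases hL with rfl | rfl | rfl | rfl
          · exact kunenEntails_proofTag
          · exact kunenEntails_proofTag
          · exact hx
          · exact .of_represents trivial ⟨r, hr, rfl, rfl⟩
        · exact kunenEntails_map_freeBody (fun a ha => hra a ha rfl _ (Or.inl rfl)) hL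
      · obtain rfl := List.mem_singleton.1 hL
        exact realized_not_overruled hs
  rcases ht with rfl | rfl
  · refine .of_metaProgram (.defeasibly_free (.proof d) x) ?_
    simp only [List.mem_cons, List.not_mem_nil, or_false, forall_eq_or_imp, forall_eq]
    exact ⟨kunenEntails_proofTag, main⟩
  · exact main

theorem realized_minus_main {x : Literal P}
    (h : Infers D d (Realized D d) (.minus (.main d) x)) (t : Tag)
    (ht : t = .free ∨ t = .proof d) :
    KunenEntails (freeProgram D) (.not (.defeasibly (.proof d) (.lit ⟨t, x⟩))) := by
  obtain ⟨h1, h2⟩ := (infers_minus_main_iff _ _ _ _).1 h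
  have hdef := KunenEntails.eventually h1
  have main : KunenEntails (freeProgram D)
      (.not (.defeasibly (.proof d) (.lit ⟨.proof d, x⟩))) := by
    have : ∀ᶠ n in atTop, ∀ r ∈ D.supportiveRules x,
        (∃ L ∈ (freeBody r.antecedent).map (fun e => ProgLit.pos (.defeasibly (.proof d) e)),
          L.IsFalse (fittingIter (freeProgram D) n)) ∨
        .definitely x.compl ∈ (fittingIter (freeProgram D) n).trueSet ∨
        .overruled (.proof d) r.label x ∈ (fittingIter (freeProgram D) n).trueSet := by
      refine (eventually_all_finite (D.finite_supportiveRules _)).2 fun r hr => ?_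
      rcases h2 r hr with ⟨a, ha, h⟩ | h | ⟨s, hs, hsa, hf⟩
      · exact (eventually_isFalse_of_exists ⟨a, ha, h rfl _ (Or.inl rfl)⟩).mono fun n => Or.inl
      · exact (KunenEntails.eventually h).mono fun n hn => Or.inr (Or.inl hn)
      · exact (realized_overruled hs hsa hf).eventually.mono fun n hn => Or.inr (Or.inr hn)
    refine .not_of_base ?_
    filter_upwards [this, hdef] with n hn hdn
    intro b hc hb
    cases hc with
    | defeasibly_definitely => exact ⟨.pos _, List.mem_cons_of_mem _ (List.mem_singleton_self _), hdn⟩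
    | defeasibly_rule _ _ _ l w =>
      obtain ⟨r, hr, rfl, rfl⟩ := hb (.supportiveRule l x w) (by simp) trivial
      rcases hn r hr with ⟨L, hL, hf⟩ | hf | hf
      · exact ⟨L, List.mem_append_left _ (List.mem_append_right _ hL), hf⟩
      · exact ⟨.not (.definitely x.compl), by simp, hf⟩
      · exact ⟨_, List.mem_append_right _ (List.mem_singleton_self _), hf⟩
  rcases ht with rfl | rfl
  -- With the tag `free`, three kinds of clauses remain: the one passing to the tag `d`, refuted by
  -- `main`; the one for definite provability; and the rule clauses, which would require `free` to
  -- be a proof tag.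
  · refine .not_of_base ?_
    filter_upwards [main.eventually, hdef] with n hn hdn
    intro b hc hb
    cases hc with
    | defeasibly_free => exact ⟨.pos _, List.mem_cons_of_mem _ (List.mem_singleton_self _), hn⟩
    | defeasibly_definitely => exact ⟨.pos _, List.mem_cons_of_mem _ (List.mem_singleton_self _), hdn⟩
    | defeasibly_rule _ _ _ l w =>
      exact absurd (hb (.proofTag .free) (by simp) trivial) not_represents_proofTag_free
  · exact main

theorem realized_plus_supp (hd : d = .delta ∨ d = .deltaStar) {x : Literal P}
    (h : Infers D d (Realized D d) (.plus (.supp d) x)) (t : Tag) (ht : t = .free ∨ t = .proof d) :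
    KunenEntails (freeProgram D) (.pos (.supported (.proof d) (.lit ⟨t, x⟩))) := by
  have main : KunenEntails (freeProgram D)
      (.pos (.supported (.proof d) (.lit ⟨.proof d, x⟩))) := by
    rcases (infers_plus_supp_iff _ _ _ _ hd).1 h with h | ⟨r, hr, hra, hs⟩
    · refine .of_metaProgram (.supported_definitely (.proof d) (.proof d) x) ?_
      simp only [List.mem_cons, List.not_mem_nil, or_false, forall_eq_or_imp, forall_eq]
      exact ⟨kunenEntails_proofTag, h⟩
    · refine .of_metaProgram
        (.supported_rule (.proof d) (.proof d) x r.label (freeBody r.antecedent)) ?_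
      intro L hL
      rcases List.mem_append.1 hL with hL | hL
      · rcases List.mem_append.1 hL with hL | hL
        · simp only [List.mem_cons, List.not_mem_nil, or_false] at hL
          rcases hL with rfl | rfl | rfl
          · exact kunenEntails_proofTag
          · exact kunenEntails_proofTag
          · exact .of_represents trivial ⟨r, hr, rfl, rfl⟩
        · exact kunenEntails_map_freeBody (fun a ha => hra a ha rfl _ (Or.inl rfl)) hL
      · obtain rfl := List.mem_singleton.1 hL
        exact realized_not_beaten hs
  rcases ht with rfl | rfl
  · refine .of_metaProgram (.supported_free (.proof d) x) ?_
    simp only [List.mem_cons, List.not_mem_nil, or_false, forall_eq_or_imp, forall_eq]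
    exact ⟨kunenEntails_proofTag, main⟩
  · exact main

theorem realized_minus_supp (hd : d = .delta ∨ d = .deltaStar) {x : Literal P}
    (h : Infers D d (Realized D d) (.minus (.supp d) x)) (t : Tag)
    (ht : t = .free ∨ t = .proof d) :
    KunenEntails (freeProgram D) (.not (.supported (.proof d) (.lit ⟨t, x⟩))) := by
  obtain ⟨h1, h2⟩ := (infers_minus_supp_iff _ _ _ _ hd).1 h
  have hdef := KunenEntails.eventually h1
  have main : KunenEntails (freeProgram D)
      (.not (.supported (.proof d) (.lit ⟨.proof d, x⟩))) := by
    have : ∀ᶠ n in atTop, ∀ r ∈ D.supportiveRules x,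
        (∃ L ∈ (freeBody r.antecedent).map (fun e => ProgLit.pos (.supported (.proof d) e)),
          L.IsFalse (fittingIter (freeProgram D) n)) ∨
        .beaten (.proof d) r.label x ∈ (fittingIter (freeProgram D) n).trueSet := by
      refine (eventually_all_finite (D.finite_supportiveRules _)).2 fun r hr => ?_
      rcases h2 r hr with ⟨a, ha, h⟩ | ⟨s, hs, hsa, hf⟩
      · exact (eventually_isFalse_of_exists ⟨a, ha, h rfl _ (Or.inl rfl)⟩).mono fun n => Or.inl
      · exact (realized_beaten hs hsa hf).eventually.mono fun n hn => Or.inr hn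
    refine .not_of_base ?_
    filter_upwards [this, hdef] with n hn hdn
    intro b hc hb
    cases hc with
    | supported_definitely => exact ⟨.pos _, List.mem_cons_of_mem _ (List.mem_singleton_self _), hdn⟩
    | supported_rule _ _ _ l w =>
      obtain ⟨r, hr, rfl, rfl⟩ := hb (.supportiveRule l x w) (by simp) trivial
      rcases hn r hr with ⟨L, hL, hf⟩ | hf
      · exact ⟨L, List.mem_append_left _ (List.mem_append_right _ hL), hf⟩
      · exact ⟨_, List.mem_append_right _ (List.mem_singleton_self _), hf⟩
  rcases ht with rfl | rfl
  · refine .not_of_base ?_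
    filter_upwards [main.eventually, hdef] with n hn hdn
    intro b hc hb
    cases hc with
    | supported_free => exact ⟨.pos _, List.mem_cons_of_mem _ (List.mem_singleton_self _), hn⟩
    | supported_definitely => exact ⟨.pos _, List.mem_cons_of_mem _ (List.mem_singleton_self _), hdn⟩
    | supported_rule _ _ _ l w =>
      exact absurd (hb (.proofTag .free) (by simp) trivial) not_represents_proofTag_free
  · exact main

/-- Closure of `Realized`, assembled from the cases above. Conclusions with a proof tag other than
`d` belong to `Realized` vacuously. -/
theorem realized_of_infers (c : Conclusion P) (h : Infers D d (Realized D d) c) :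
    c ∈ Realized D d := by
  rcases c with ⟨_ | d' | d', x⟩ | ⟨_ | d' | d', x⟩
  · exact realized_plus_definite h
  · rintro rfl t ht
    exact realized_plus_main h t ht
  · rintro rfl t ht
    -- That `d` is `delta` or `deltaStar` is read off the inference itself, since only these systems
    -- infer support conclusions.
    exact realized_plus_supp (by cases h; assumption) h t ht
  · exact realized_minus_definite h
  · rintro rfl t ht
    exact realized_minus_main h t ht
  · rintro rfl t ht
    exact realized_minus_supp (by cases h; assumption) h t ht

end Completeness

end ADL

/-! ### The conservative extension theorem. -/

theorem mainTheorem2 {P Λ : Type*} (D : ADL.DefeasibleTheory P Λ) (d : ADL.ProofTag)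
    (q : ADL.Literal P) (t : ADL.Tag) (ht : t = ADL.Tag.free ∨ t = ADL.Tag.proof d) :
    ((ADL.KunenEntails (ADL.metaProgram (D.annotate (ADL.freeAnnotation Λ)))
          (.pos (.defeasibly (.proof d) (.lit ⟨t, q⟩))) ↔
        ADL.Derives D d (.plus (.main d) q)) ∧
      (ADL.KunenEntails (ADL.metaProgram (D.annotate (ADL.freeAnnotation Λ)))
          (.not (.defeasibly (.proof d) (.lit ⟨t, q⟩))) ↔
        ADL.Derives D d (.minus (.main d) q))) ∧
    (d = ADL.ProofTag.delta ∨ d = ADL.ProofTag.deltaStar →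
      (ADL.KunenEntails (ADL.metaProgram (D.annotate (ADL.freeAnnotation Λ)))
          (.pos (.supported (.proof d) (.lit ⟨t, q⟩))) ↔
        ADL.Derives D d (.plus (.supp d) q)) ∧
      (ADL.KunenEntails (ADL.metaProgram (D.annotate (ADL.freeAnnotation Λ)))
          (.not (.supported (.proof d) (.lit ⟨t, q⟩))) ↔
        ADL.Derives D d (.minus (.supp d) q))) := by
  -- Closure of the derivable set makes it a legitimate `S` for soundness; its minimality, used in
  -- `complete`, places it inside `Realized`.
  have hS : ∀ c, ADL.Infers D d {a | ADL.Derives D d a} c → c ∈ {a | ADL.Derives D d a} :=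
    fun _ h => ADL.Derives.of_infers h
  have ht' : ADL.BodyExpr.lit ⟨t, q⟩ = .lit ⟨.free, q⟩ ∨
      ADL.BodyExpr.lit ⟨t, q⟩ = .lit ⟨.proof d, q⟩ :=
    ht.imp (by rintro rfl; rfl) (by rintro rfl; rfl)
  have complete : ∀ {c}, ADL.Derives D d c → c ∈ ADL.Realized D d :=
    fun h => ADL.Derives.mem_of_closed ADL.realized_of_infers h
  exact ⟨⟨⟨fun h => ADL.kunenEntails_sound hS h q rfl ht', fun h => complete h rfl t ht⟩,
      ⟨fun h => ADL.kunenEntails_sound hS h q rfl ht', fun h => complete h rfl t ht⟩⟩,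
    fun hd => ⟨⟨fun h => ADL.kunenEntails_sound hS h q rfl ht' hd, fun h => complete h rfl t ht⟩,
      ⟨fun h => ADL.kunenEntails_sound hS h q rfl ht' hd, fun h => complete h rfl t ht⟩⟩⟩
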